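/- Computation model. Let $K$ be a linearly ordered field (e.g. $\mathbb{Q}$ or $\mathbb{R}$). Programs run on a unit-cost RAM with index registers (natural numbers; addition, truncated subtraction, comparison), number registers (elements of $K$; integer constants, $+,-,\times,\div$, comparison) and finitely many arrays of both kinds, addressed by index registers; each instruction costs one step. Matrix multiplication. A program multiplies $p\times q$ by $q\times r$ matrices over $K$ in time $t$ if, for all such matrices, it stops with their product within $t$ steps; such a time bound $t$ is, as usual, understood to be at least the input and output size $pq+qr+pr$. Let $\omega(a,b,c)$ be the infimum of all real $\tau$ such that some program multiplies $p\times q$ by $q\times r$ matrices, for all $p\le N^a$, $q\le N^b$, $r\le N^c$, in time $O(N^\tau)$. Graphs and flows. Let $G$ be a directed graph on $n$ nodes (an undirected graph is a symmetric directed one) with nonnegative capacities in $K$ either on its edges or on its nodes. For nodes $u\ne v$, a $uv$-flow is a nonnegative function on the edges that is conserved at all nodes other than $u,v$ and respects the capacity of every edge, respectively the capacity of every node other than $u,v$ (bounding the total flow through that node). Its value is the outflow minus the inflow at $u$, and its volume $\mathrm{vol}$ is the number of edges carrying nonzero flow. An instance consists of $G$ (given by its weight or adjacency matrix and its node capacities)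 and a nonempty set $Q\subseteq V\times V$ of pairs of distinct nodes; a solution is the list of maximum $uv$-flow values for $(u,v)\in Q$. For a set $D$ of shapes and a function $T$, say that all Max-Flow values for the pairs in $Q$ can be computed nondeterministically in time $O\big(T(|Q|,n)+\sum_{(u,v)\in Q}\mathrm{vol}(f_{uv})\big)$ on $D$ if there are a program $M$ and a constant $C$ such that, for all instances with $(|Q|,n)\in D$ and every budget $B\in\mathbb{N}$ given to $M$: (a) for every (finite) guess $g$, $M$ stops within $C\,(T(|Q|,n)+B)$ steps; (b) for every guess $g$, $M$ outputs either a solution or "don't know"; (c) whenever $(f_{uv})_{(u,v)\in Q}$ are any maximum $uv$-flows in $G$ with $\sum_{(u,v)\in Q}\mathrm{vol}(f_{uv})\le B$, some guess makes $M$ output a solution. (The budget may equally be regarded as part of the guess; then, for any choice of maximum flows $f_{uv}$, some guess yields a solution in time $O(T(|Q|,n)+\sum\mathrm{vol}(f_{uv}))$.) Lemma. 1. For every set $D$ of shapes and every $T$ such that some program multiplies $q\times n$ by $n\times n$ matrices over $K$ in time $T(q,n)$ for all $(q,n)\in D$, all Max-Flow values for the pairs in $Q$ can be computed nondeterministically in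 time $O\big(T(|Q|,n)+\sum_{(u,v)\in Q}\mathrm{vol}(f_{uv})\big)$ on $D$. That is, if $n^{\omega(\log_n|Q|,1,1)}$ denotes the time it takes to multiply a $|Q|\times n$ by an $n\times n$ matrix, the time is $O\big(n^{\omega(\log_n|Q|,1,1)}+\sum_{(u,v)\in Q}\mathrm{vol}(f_{uv})\big)$. 2. In particular, with $\omega$ as the infimum defined above: for all real $\kappa$ and $\tau>\omega(\kappa,1,1)$, on instances with $|Q|\le n^\kappa$ the time is $O\big(n^{\tau}+\sum_{(u,v)\in Q}\mathrm{vol}(f_{uv})\big)$. -/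

import Mathlib

/-! ### The machine model: a unit-cost RAM over an ordered field

A machine has index registers holding natural numbers, number registers holding elements of the
ordered field `K`, and arrays of both kinds.  Array cells are addressed by the name of the array,
which is fixed in the program, and by the contents of two index registers.  Every instruction
costs one step.  Indices can be added, subtracted and compared; numbers can be added, subtracted,
multiplied, divided and compared; the only constants for numbers are the integers. -/

namespace NumRAM

/-- Instructions.  Operands are names of registers or arrays, `l` is the number of an instruction
of the program. -/
inductive Instr where
  /-- index register `d` := the constant `k` -/
  | idxConst (d k : ℕ)
  /-- index register `d` := register `a` + register `b` -/
  | idxAdd (d a b : ℕ)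
  /-- index register `d` := register `a` - register `b`, truncated at zero -/
  | idxSub (d a b : ℕ)
  /-- index register `d` := cell `(i, j)` of index array `arr`, with `i`, `j` held in registers -/
  | idxLoad (d arr i j : ℕ)
  /-- cell `(i, j)` of index array `arr`, with `i`, `j` held in registers, := register `a` -/
  | idxStore (arr i j a : ℕ)
  /-- number register `d` := the integer `z` -/
  | numConst (d : ℕ) (z : ℤ)
  | numAdd (d a b : ℕ)
  | numSub (d a b : ℕ)
  | numMul (d a b : ℕ)
  | numDiv (d a b : ℕ)
  /-- number register `d` := cell `(i, j)` of number array `arr` -/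
  | numLoad (d arr i j : ℕ)
  /-- cell `(i, j)` of number array `arr` := number register `a` -/
  | numStore (arr i j a : ℕ)
  /-- go to `l` if index register `a` ≤ index register `b` -/
  | idxJump (a b l : ℕ)
  /-- go to `l` if number register `a` ≤ number register `b` -/
  | numJump (a b l : ℕ)
  /-- stop; `ok = true` means that the output is delivered, `ok = false` means "don't know" -/
  | halt (ok : Bool)

/-- A program is a finite list of instructions. -/
abbrev Program := List Instr

/-- A configuration of the machine. -/
structure State (K : Type*) where
  pc : ℕ
  idx : ℕ → ℕ
  num : ℕ → K
  idxArr : ℕ → ℕ → ℕ → ℕ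
  numArr : ℕ → ℕ → ℕ → K

/-- Overwrite cell `(i, j)` of array `arr`. -/
def setCell {α : Type*} (m : ℕ → ℕ → ℕ → α) (arr i j : ℕ) (x : α) : ℕ → ℕ → ℕ → α :=
  fun a b c => if a = arr ∧ b = i ∧ c = j then x else m a b c

variable {K : Type*} [Field K] [LinearOrder K]

/-- The effect of one instruction. -/
def exec (s : State K) : Instr → State K
  | .idxConst d k => { s with pc := s.pc + 1, idx := Function.update s.idx d k }
  | .idxAdd d a b =>
      { s with pc := s.pc + 1, idx := Function.update s.idx d (s.idx a + s.idx b) }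
  | .idxSub d a b =>
      { s with pc := s.pc + 1, idx := Function.update s.idx d (s.idx a - s.idx b) }
  | .idxLoad d arr i j =>
      { s with pc := s.pc + 1
               idx := Function.update s.idx d (s.idxArr arr (s.idx i) (s.idx j)) }
  | .idxStore arr i j a =>
      { s with pc := s.pc + 1
               idxArr := setCell s.idxArr arr (s.idx i) (s.idx j) (s.idx a) }
  | .numConst d z => { s with pc := s.pc + 1, num := Function.update s.num d (z : K) }
  | .numAdd d a b =>
      { s with pc := s.pc + 1, num := Function.update s.num d (s.num a + s.num b) }
  | .numSub d a b =>
      { s with pc := s.pc + 1, num := Function.update s.num d (s.num a - s.num b) }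
  | .numMul d a b =>
      { s with pc := s.pc + 1, num := Function.update s.num d (s.num a * s.num b) }
  | .numDiv d a b =>
      { s with pc := s.pc + 1, num := Function.update s.num d (s.num a / s.num b) }
  | .numLoad d arr i j =>
      { s with pc := s.pc + 1
               num := Function.update s.num d (s.numArr arr (s.idx i) (s.idx j)) }
  | .numStore arr i j a =>
      { s with pc := s.pc + 1
               numArr := setCell s.numArr arr (s.idx i) (s.idx j) (s.num a) }
  | .idxJump a b l => { s with pc := if s.idx a ≤ s.idx b then l else s.pc + 1 }
  | .numJump a b l => { s with pc := if s.num a ≤ s.num b then l else s.pc + 1 }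
  | .halt _ => s

/-- One step.  A `halt` instruction is never left; outside the program the machine hangs. -/
def step (P : Program) (s : State K) : State K :=
  match P[s.pc]? with
  | some i => exec s i
  | none => s

/-- Started in `s`, the program `P` stops after at most `t` steps, with answer `ok` and in the
final configuration `s'`. -/
def HaltsWithin (P : Program) (s : State K) (t : ℕ) (ok : Bool) (s' : State K) : Prop :=
  (step P)^[t] s = s' ∧ P[s'.pc]? = some (Instr.halt ok)

/-- A finite table as the contents of an array, padded by zeros. -/
def table {α : Type*} [Zero α] {p q : ℕ} (f : Fin p → Fin q → α) : ℕ → ℕ → α :=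
  fun i j => if h : i < p ∧ j < q then f ⟨i, h.1⟩ ⟨j, h.2⟩ else 0

/-! ### The time of rectangular matrix multiplication -/

/-- Initial configuration for multiplying `A` by `B`: the dimensions are in the index registers
`0`, `1`, `2`, the matrices in the number arrays `0` and `1`; everything else is zero. -/
def mulInit {p q r : ℕ} (A : Matrix (Fin p) (Fin q) K) (B : Matrix (Fin q) (Fin r) K) :
    State K where
  pc := 0
  idx := fun i => if i = 0 then p else if i = 1 then q else if i = 2 then r else 0
  num := fun _ => 0
  idxArr := fun _ _ _ => 0
  numArr := fun a =>
    if a = 0 then table A else if a = 1 then table B else fun _ _ => 0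

variable (K)

/-- `P` multiplies all `p × q` matrices by `q × r` matrices over `K` in time `t`, leaving the
product in the number array `2`.  As usual, time is at least the size of the input and output. -/
def MultipliesWithin (P : Program) (p q r : ℕ) (t : ℝ) : Prop :=
  ((p * q + q * r + p * r : ℕ) : ℝ) ≤ t ∧
  ∀ (A : Matrix (Fin p) (Fin q) K) (B : Matrix (Fin q) (Fin r) K),
    ∃ (k : ℕ) (s' : State K), (k : ℝ) ≤ t ∧ HaltsWithin P (mulInit A B) k true s' ∧
      ∀ (i : Fin p) (j : Fin r), s'.numArr 2 i j = (A * B) i j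

/-- Some program multiplies `q × n` matrices by `n × n` matrices in time `T q n`, for all shapes
`(q, n)` in `D`. -/
def RectMatMulTime (D : Set (ℕ × ℕ)) (T : ℕ → ℕ → ℝ) : Prop :=
  ∃ P : Program, ∀ q n : ℕ, (q, n) ∈ D → MultipliesWithin K P q n n (T q n)

/-- The exponent `ω(a, b, c)` of rectangular matrix multiplication over `K`: the infimum of all
`τ` such that some program multiplies `N ^ a × N ^ b` matrices by `N ^ b × N ^ c` matrices
(or smaller ones) in time `O(N ^ τ)`. -/
noncomputable def omega (a b c : ℝ) : EReal :=
  sInf {x : EReal | ∃ τ : ℝ, x = (τ : EReal) ∧ ∃ (P : Program) (C : ℝ),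
    ∀ N p q r : ℕ, 1 ≤ N → (p : ℝ) ≤ (N : ℝ) ^ a → (q : ℝ) ≤ (N : ℝ) ^ b →
      (r : ℝ) ≤ (N : ℝ) ^ c → MultipliesWithin K P p q r (C * (N : ℝ) ^ τ)}

end NumRAM

/-! ### Capacitated graphs, flows and maximum flows -/

namespace MaxFlow

open NumRAM

/-- A directed graph on `Fin n` with capacities either on its edges or on its nodes.
In an edge-capacitated graph the edges are the pairs of positive capacity.  Undirected graphs are
the symmetric ones. -/
inductive CapGraph (K : Type*) [Field K] [LinearOrder K] (n : ℕ) where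
  | edgeCap (c : Fin n → Fin n → K) (nonneg : ∀ a b, 0 ≤ c a b)
  | nodeCap (adj : Fin n → Fin n → Bool) (c : Fin n → K) (nonneg : ∀ w, 0 ≤ c w)

variable {K : Type*} [Field K] [LinearOrder K] {n : ℕ}

/-- The capacity constraints on an `st`-flow: on each edge, or on the flow through each
node other than `s` and `t`. -/
def CapGraph.Respects (G : CapGraph K n) (s t : Fin n) (f : Fin n → Fin n → K) : Prop :=
  match G with
  | .edgeCap c _ => ∀ a b, f a b ≤ c a b
  | .nodeCap adj c _ =>
      (∀ a b, f a b ≠ 0 → adj a b = true) ∧ ∀ w, w ≠ s → w ≠ t → ∑ b, f w b ≤ c w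

/-- `f` is an `st`-flow in `G`. -/
structure IsFlow (G : CapGraph K n) (s t : Fin n) (f : Fin n → Fin n → K) : Prop where
  nonneg : ∀ a b, 0 ≤ f a b
  respects : G.Respects s t f
  conservation : ∀ w, w ≠ s → w ≠ t → ∑ b, f w b = ∑ b, f b w

/-- The value of a flow with source `s`. -/
def val (s : Fin n) (f : Fin n → Fin n → K) : K := ∑ b, f s b - ∑ b, f b s

/-- The volume of a flow: the number of edges in its support. -/
def vol (f : Fin n → Fin n → K) : ℕ :=
  (Finset.univ.filter fun e : Fin n × Fin n => f e.1 e.2 ≠ 0).card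

/-- `f` is a maximum `st`-flow in `G`. -/
def IsMaxFlow (G : CapGraph K n) (s t : Fin n) (f : Fin n → Fin n → K) : Prop :=
  IsFlow G s t f ∧ ∀ f', IsFlow G s t f' → val s f' ≤ val s f

/-- `p` is the maximum value of an `st`-flow in `G`. -/
def IsMaxFlowValue (G : CapGraph K n) (s t : Fin n) (p : K) : Prop :=
  IsGreatest {x : K | ∃ f, IsFlow G s t f ∧ val s f = x} p

/-- A graph together with a nonempty set of `q` pairs of distinct nodes, listed in some order. -/
structure Query (K : Type*) [Field K] [LinearOrder K] (n q : ℕ) where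
  graph : CapGraph K n
  pair : Fin q → Fin n × Fin n
  injective : Function.Injective pair
  distinct : ∀ i, (pair i).1 ≠ (pair i).2
  nonempty : 0 < q

/-! ### Nondeterministic computation of maximum flow values -/

/-- A guess: finitely many natural numbers and numbers from `K`, written into two arrays. -/
structure Guess (K : Type*) [Zero K] where
  idx : ℕ × ℕ →₀ ℕ
  num : ℕ × ℕ →₀ K

/-- `0` for edge capacities and `1` for node capacities. -/
def CapGraph.kind : CapGraph K n → ℕ
  | .edgeCap _ _ => 0
  | .nodeCap _ _ _ => 1

/-- The weight matrix of the graph: the edge capacities, or the `0`-`1` adjacency matrix. -/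
def CapGraph.weight : CapGraph K n → Fin n → Fin n → K
  | .edgeCap c _ => c
  | .nodeCap adj _ _ => fun a b => if adj a b then 1 else 0

/-- The node capacities, in one column (zeros for edge-capacitated graphs). -/
def CapGraph.nodeWeight : CapGraph K n → Fin n → Fin 1 → K
  | .edgeCap _ _ => fun _ _ => 0
  | .nodeCap _ c _ => fun w _ => c w

/-- The initial configuration on query `x`, volume budget `B` and guess `g`.
Index registers `0` to `3`: `n`, `q`, `B` and the kind of capacities.
Number arrays `0`, `1`: weight matrix and node capacities.  Index array `0`: row `i` holds the
`i`-th pair.  Index array `1` and number array `2`: the guess.  Everything else is zero. -/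
def queryInit {q : ℕ} (x : Query K n q) (B : ℕ) (g : Guess K) : State K where
  pc := 0
  idx := fun i => if i = 0 then n else if i = 1 then q else if i = 2 then B
    else if i = 3 then x.graph.kind else 0
  num := fun _ => 0
  idxArr := fun a =>
    if a = 0 then table (fun (i : Fin q) (j : Fin 2) =>
      if j = 0 then ((x.pair i).1 : ℕ) else ((x.pair i).2 : ℕ))
    else if a = 1 then fun i j => g.idx (i, j) else fun _ _ => 0
  numArr := fun a =>
    if a = 0 then table x.graph.weight
    else if a = 1 then table x.graph.nodeWeight
    else if a = 2 then fun i j => g.num (i, j) else fun _ _ => 0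

/-- The output in column `0` of number array `3` is the list of all maximum flow values. -/
def IsSolution {q : ℕ} (x : Query K n q) (s : State K) : Prop :=
  ∀ i : Fin q, IsMaxFlowValue x.graph (x.pair i).1 (x.pair i).2 (s.numArr 3 i 0)

variable (K)

/-- There is one nondeterministic program that computes the maximum flow values of all pairs, for
all queries of shape `(q, n)` in `D`, in time `O(T q n + ∑ vol (f i))`, for any maximum flows `f i`:
with a budget `B` for the total volume, it stops within `O(T q n + B)` steps on every guess, it
then delivers either a solution or "don't know", and some guess leads to a solution as soon as
`B` is at least the total volume of some family of maximum flows for the pairs. -/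
def NondetMaxFlowTime (D : Set (ℕ × ℕ)) (T : ℕ → ℕ → ℝ) : Prop :=
  ∃ (M : Program) (C : ℝ), ∀ (n q : ℕ), (q, n) ∈ D → ∀ (x : Query K n q) (B : ℕ),
    (∀ g : Guess K, ∃ (k : ℕ) (ok : Bool) (s' : State K),
      (k : ℝ) ≤ C * (T q n + B) ∧ HaltsWithin M (queryInit x B g) k ok s' ∧
      (ok = true → IsSolution x s')) ∧
    (∀ f : Fin q → Fin n → Fin n → K,
      (∀ i, IsMaxFlow x.graph (x.pair i).1 (x.pair i).2 (f i)) → ∑ i, vol (f i) ≤ B →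
      ∃ (g : Guess K) (k : ℕ) (s' : State K), HaltsWithin M (queryInit x B g) k true s')

end MaxFlow

/-!
The program verifies a guess that consists of a flow and of a cut for every pair of nodes.

A guess lists the edges that carry flow, each together with its pair and its amount, so reading it
takes `O(B)` steps; constant work per pair and node then shows whether every pair has a feasible
flow. For each pair `(u, v)` the guess also marks a set `S` of nodes that contains `u` but not
`v`. Its capacity bounds the value of every `uv`-flow (`MaxFlow.IsFlow.val_le_cutCap`), so a flow
of at least this value is a maximum flow, and the capacity is the number to be delivered. The
capacities of all the cuts are found by a single matrix multiplication: if the rows of `Y` are the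
indicator vectors of the sets `S` and `W` is the weight matrix, then entry `(i, w)` of `Y * W` is
the total weight of the edges from the `i`-th set to `w`. With capacities on the edges, the sum
over the nodes `w` outside `S` is the capacity of the cut; with capacities on the nodes, the entry
shows whether `w` is the head of an edge that leaves `S`, and the capacities of all such heads
outside `S` are added up, while `v` must not be one of them (`MaxFlow.guessCap_eq_cutCap`).

Conversely, any maximum flows are part of an accepted guess, because there are cuts of the same
values (`MaxFlow.exists_cut_of_isMaxFlow`). The set of nodes that are reachable in the residual
graph is such a cut. Instead of augmenting along a path, the proof shows by induction on
reachability that every reachable node is the end of a feasible direction of value one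
(`MaxFlow.exists_saturated_cut`). Capacities on nodes are reduced to capacities on edges by
splitting the nodes.

The program is written in a small language of structured programs with conditionals and counting
loops, whose compilation to the machine is proved correct together with a time bound
(`NumRAM.Cmd.exists_iterate_step`). The given program for matrix multiplication becomes a
subroutine under new names of registers and arrays (`NumRAM.exists_iterate_step_relocate`). Failed tests
only set a flag, which is inspected at the very end, so that all loops run to their ends whatever
the guess is. `MaxFlow.verifier_spec` collects what the program does.
-/

/-! ### Structured programs and their compilation -/

namespace NumRAM

variable {K : Type*} [Field K] [LinearOrder K]

@[simp] theorem setCell_self {α : Type*} (m : ℕ → ℕ → ℕ → α) (arr i j : ℕ) (x : α) :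
    setCell m arr i j x arr = fun b c => if b = i ∧ c = j then x else m arr b c := by
  funext b c; simp [setCell]

@[simp] theorem setCell_of_ne {α : Type*} (m : ℕ → ℕ → ℕ → α) {a arr : ℕ} (h : a ≠ arr)
    (i j : ℕ) (x : α) : setCell m arr i j x a = m a := by
  funext b c; simp [setCell, h]

/-- The segment `L` of code sits at position `b` in the program `M`. -/
def CodeAt (M : Program) (b : ℕ) (L : List Instr) : Prop :=
  ∃ pre post, M = pre ++ L ++ post ∧ pre.length = b

theorem CodeAt.left {M : Program} {b : ℕ} {L₁ L₂ : List Instr} (h : CodeAt M b (L₁ ++ L₂)) :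
    CodeAt M b L₁ := by
  obtain ⟨pre, post, rfl, hb⟩ := h
  exact ⟨pre, L₂ ++ post, by simp, hb⟩

theorem CodeAt.right {M : Program} {b c : ℕ} {L₁ L₂ : List Instr} (h : CodeAt M b (L₁ ++ L₂))
    (hc : c = b + L₁.length) : CodeAt M c L₂ := by
  obtain ⟨pre, post, rfl, hb⟩ := h
  exact ⟨pre ++ L₁, post, by simp, by simp [hb, hc]⟩

theorem CodeAt.get? {M : Program} {b : ℕ} {L : List Instr} (h : CodeAt M b L) {i : ℕ}
    (hi : i < L.length) : M[b + i]? = L[i]? := by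
  obtain ⟨pre, post, rfl, rfl⟩ := h
  rw [List.append_assoc, List.getElem?_append_right (by omega),
    List.getElem?_append_left (by omega)]
  simp

theorem CodeAt.step_eq {M : Program} {b : ℕ} {i : Instr} {L : List Instr}
    (h : CodeAt M b (i :: L)) {s : State K} (hs : s.pc = b) : step M s = exec s i := by
  have := h.get? (i := 0) (by simp)
  simp only [Nat.add_zero, List.getElem?_cons_zero] at this
  simp [step, hs, this]

theorem CodeAt.tail {M : Program} {b c : ℕ} {i : Instr} {L : List Instr}
    (h : CodeAt M b (i :: L)) (hc : c = b + 1) : CodeAt M c L :=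
  CodeAt.right (L₁ := [i]) h hc

/-- The index registers that an instruction writes to. -/
def Instr.idxWrites : Instr → List ℕ
  | .idxConst d _ | .idxAdd d _ _ | .idxSub d _ _ | .idxLoad d _ _ _ => [d]
  | _ => []

/-- The number registers that an instruction writes to. -/
def Instr.numWrites : Instr → List ℕ
  | .numConst d _ | .numAdd d _ _ | .numSub d _ _ | .numMul d _ _ | .numDiv d _ _
  | .numLoad d _ _ _ => [d]
  | _ => []

/-- The index arrays that an instruction writes to. -/
def Instr.idxArrWrites : Instr → List ℕ
  | .idxStore arr _ _ _ => [arr]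
  | _ => []

/-- The number arrays that an instruction writes to. -/
def Instr.numArrWrites : Instr → List ℕ
  | .numStore arr _ _ _ => [arr]
  | _ => []

/-- Instructions after which the program goes on with the next instruction. -/
def Instr.straight : Instr → Bool
  | .idxJump _ _ _ | .numJump _ _ _ | .halt _ => false
  | _ => true

/-- Structured programs.  Index register `4` is reserved for the increment of loop counters. -/
inductive Cmd where
  | skip
  | ins (i : Instr)
  | seq (c₁ c₂ : Cmd)
  /-- if index register `a` ≤ index register `b` then `c₁` else `c₂` -/
  | ifIdx (a b : ℕ) (c₁ c₂ : Cmd)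
  /-- if number register `a` ≤ number register `b` then `c₁` else `c₂` -/
  | ifNum (a b : ℕ) (c₁ c₂ : Cmd)
  /-- for index register `r` from zero up to, but not including, register `b` do `c` -/
  | loop (r b : ℕ) (c : Cmd)

/-- Sequential composition of structured programs. -/
infixr:60 " ;; " => Cmd.seq

/-- Overwrite an index register. -/
def State.setIdx (s : State K) (r v : ℕ) : State K := { s with idx := Function.update s.idx r v }

namespace Cmd

/-- The effect of a structured program on the memory; the program counter is left alone. -/
def run : Cmd → State K → State K
  | skip, s => s
  | ins i, s => { exec s i with pc := s.pc }
  | seq c₁ c₂, s => c₂.run (c₁.run s)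
  | ifIdx a b c₁ c₂, s => if s.idx a ≤ s.idx b then c₁.run s else c₂.run s
  | ifNum a b c₁ c₂, s => if s.num a ≤ s.num b then c₁.run s else c₂.run s
  | loop r b c, s =>
      Nat.rec (motive := fun _ => State K) (s.setIdx r 0)
        (fun j s' => ((c.run s').setIdx 4 1).setIdx r (j + 1)) (s.idx b)

/-- The number of instructions of the compiled program. -/
def len : Cmd → ℕ
  | skip => 0
  | ins _ => 1
  | seq c₁ c₂ => c₁.len + c₂.len
  | ifIdx _ _ c₁ c₂ => c₁.len + c₂.len + 2
  | ifNum _ _ c₁ c₂ => c₁.len + c₂.len + 2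
  | loop _ _ c => c.len + 5

/-- The compiled program, to be placed at position `p`. -/
def code : Cmd → ℕ → List Instr
  | skip, _ => []
  | ins i, _ => [i]
  | seq c₁ c₂, p => c₁.code p ++ c₂.code (p + c₁.len)
  | ifIdx a b c₁ c₂, p =>
      .idxJump a b (p + 2 + c₂.len) :: (c₂.code (p + 1) ++
        .idxJump 0 0 (p + 2 + c₂.len + c₁.len) :: c₁.code (p + 2 + c₂.len))
  | ifNum a b c₁ c₂, p =>
      .numJump a b (p + 2 + c₂.len) :: (c₂.code (p + 1) ++
        .idxJump 0 0 (p + 2 + c₂.len + c₁.len) :: c₁.code (p + 2 + c₂.len))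
  | loop r b c, p =>
      .idxConst r 0 :: .idxJump b r (p + 5 + c.len) :: (c.code (p + 2) ++
        [.idxConst 4 1, .idxAdd r r 4, .idxJump 0 0 (p + 1)])

/-- A bound for the running time in terms of the index registers, which hold the bounds of the
loops; for a conditional the costs of both branches are added. -/
def cost : Cmd → (ℕ → ℕ) → ℕ
  | skip, _ => 0
  | ins _, _ => 1
  | seq c₁ c₂, f => c₁.cost f + c₂.cost f
  | ifIdx _ _ c₁ c₂, f => c₁.cost f + c₂.cost f + 2
  | ifNum _ _ c₁ c₂, f => c₁.cost f + c₂.cost f + 2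
  | loop _ b c, f => f b * (c.cost f + 4) + 2

/-- The names written to, where `w` collects those of a single instruction and `l` those
written by the counting mechanism of a loop. -/
def writes (w : Instr → List ℕ) (l : ℕ → List ℕ) : Cmd → List ℕ
  | skip => []
  | ins i => w i
  | seq c₁ c₂ => c₁.writes w l ++ c₂.writes w l
  | ifIdx _ _ c₁ c₂ => c₁.writes w l ++ c₂.writes w l
  | ifNum _ _ c₁ c₂ => c₁.writes w l ++ c₂.writes w l
  | loop r _ c => l r ++ c.writes w l

/-- The index registers written to. -/
def idxWrites (c : Cmd) : List ℕ := c.writes Instr.idxWrites fun r => [4, r]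

/-- The number registers written to. -/
def numWrites (c : Cmd) : List ℕ := c.writes Instr.numWrites fun _ => []

/-- The index arrays written to. -/
def idxArrWrites (c : Cmd) : List ℕ := c.writes Instr.idxArrWrites fun _ => []

/-- The number arrays written to. -/
def numArrWrites (c : Cmd) : List ℕ := c.writes Instr.numArrWrites fun _ => []

/-- A structured program is well-formed if it leaves the index registers `0` to `3` alone, only
these serve as bounds of loops, and the body of a loop does not change its counter. -/
def WellFormed : Cmd → Prop
  | skip => True
  | ins i => i.straight ∧ ∀ x ∈ i.idxWrites, 5 ≤ x
  | seq c₁ c₂ => c₁.WellFormed ∧ c₂.WellFormed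
  | ifIdx _ _ c₁ c₂ => c₁.WellFormed ∧ c₂.WellFormed
  | ifNum _ _ c₁ c₂ => c₁.WellFormed ∧ c₂.WellFormed
  | loop r b c => c.WellFormed ∧ 5 ≤ r ∧ b < 4 ∧ r ∉ c.idxWrites

@[simp] theorem code_length (c : Cmd) (p : ℕ) : (c.code p).length = c.len := by
  induction c generalizing p <;> simp_all [code, len] <;> omega

/-- The frame rule: what is not written to does not change.  It is stated for a
component `π` of the memory. -/
theorem run_frame {α : Type*} (π : State K → α) (w : Instr → List ℕ) (l : ℕ → List ℕ) (x : ℕ)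
    (hw : ∀ i (s : State K), x ∉ w i → π { exec s i with pc := s.pc } = π s)
    (hl : ∀ r v (s : State K), x ∉ l r → π ((s.setIdx 4 1).setIdx r v) = π s)
    (hl' : ∀ r (s : State K), x ∉ l r → π (s.setIdx r 0) = π s)
    (c : Cmd) (s : State K) (hx : x ∉ c.writes w l) : π (c.run s) = π s := by
  induction c generalizing s with
  | skip => rfl
  | ins i => exact hw i s hx
  | seq c₁ c₂ h₁ h₂ =>
    simp only [writes, List.mem_append, not_or] at hx
    simp [run, h₁ _ hx.1, h₂ _ hx.2]
  | ifIdx a b c₁ c₂ h₁ h₂ =>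
    simp only [writes, List.mem_append, not_or] at hx
    simp only [run]; split_ifs <;> simp [h₁ _ hx.1, h₂ _ hx.2]
  | ifNum a b c₁ c₂ h₁ h₂ =>
    simp only [writes, List.mem_append, not_or] at hx
    simp only [run]; split_ifs <;> simp [h₁ _ hx.1, h₂ _ hx.2]
  | loop r b c h =>
    simp only [writes, List.mem_append, not_or] at hx
    simp only [run]
    generalize s.idx b = N
    induction N with
    | zero => exact hl' r s hx.1
    | succ N ih => simp only [hl _ _ _ hx.1, h _ hx.2, ih]

theorem run_idx (c : Cmd) (s : State K) {x : ℕ} (hx : x ∉ c.idxWrites) :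
    (c.run s).idx x = s.idx x := by
  refine run_frame (fun s => s.idx x) _ _ x ?_ ?_ ?_ c s hx
  · intro i s h
    cases i <;> simp_all [exec, Instr.idxWrites]
  · intro r v s h
    simp_all [State.setIdx]
  · intro r s h
    simp_all [State.setIdx]

theorem run_num (c : Cmd) (s : State K) {x : ℕ} (hx : x ∉ c.numWrites) :
    (c.run s).num x = s.num x := by
  refine run_frame (fun s => s.num x) _ _ x ?_ (fun _ _ _ _ => rfl) (fun _ _ _ => rfl) c s hx
  intro i s h
  cases i <;> simp_all [exec, Instr.numWrites]

theorem run_idxArr (c : Cmd) (s : State K) {x : ℕ} (hx : x ∉ c.idxArrWrites) :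
    (c.run s).idxArr x = s.idxArr x := by
  refine run_frame (fun s => s.idxArr x) _ _ x ?_ (fun _ _ _ _ => rfl) (fun _ _ _ => rfl) c s hx
  intro i s h
  cases i <;> simp_all [exec, Instr.idxArrWrites]

theorem run_numArr (c : Cmd) (s : State K) {x : ℕ} (hx : x ∉ c.numArrWrites) :
    (c.run s).numArr x = s.numArr x := by
  refine run_frame (fun s => s.numArr x) _ _ x ?_ (fun _ _ _ _ => rfl) (fun _ _ _ => rfl) c s hx
  intro i s h
  cases i <;> simp_all [exec, Instr.numArrWrites]

/-- The registers of the input are not written to. -/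
theorem WellFormed.four_le {c : Cmd} (hc : c.WellFormed) {x : ℕ} (hx : x ∈ c.idxWrites) :
    4 ≤ x := by
  induction c with
  | skip => simp [idxWrites, writes] at hx
  | ins i =>
    exact (Nat.le_succ 4).trans (hc.2 x hx)
  | seq c₁ c₂ h₁ h₂ | ifIdx _ _ c₁ c₂ h₁ h₂ | ifNum _ _ c₁ c₂ h₁ h₂ =>
    exact (List.mem_append.1 hx).elim (h₁ hc.1) (h₂ hc.2)
  | loop r b c h =>
    rcases List.mem_append.1 hx with hx | hx
    · simp only [List.mem_cons, List.not_mem_nil, or_false] at hx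
      have := hc.2.1
      omega
    · exact h hc.1 hx

theorem WellFormed.run_idx {c : Cmd} (hc : c.WellFormed) (s : State K) {x : ℕ} (hx : x < 4) :
    (c.run s).idx x = s.idx x :=
  Cmd.run_idx c s fun h => by have := hc.four_le h; omega

theorem WellFormed.cost_congr {c : Cmd} (hc : c.WellFormed) {f g : ℕ → ℕ}
    (h : ∀ x < 4, f x = g x) : c.cost f = c.cost g := by
  induction c with
  | skip => rfl
  | ins i => rfl
  | seq c₁ c₂ h₁ h₂ | ifIdx _ _ c₁ c₂ h₁ h₂ | ifNum _ _ c₁ c₂ h₁ h₂ =>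
    simp [cost, h₁ hc.1, h₂ hc.2]
  | loop r b c h' =>
    simp [cost, h' hc.1, h b hc.2.2.1]

/-- The state with its program counter set to `p`. -/
def _root_.NumRAM.State.atPc (s : State K) (p : ℕ) : State K := { s with pc := p }

theorem run_atPc (c : Cmd) (s : State K) (p : ℕ) : c.run (s.atPc p) = (c.run s).atPc p := by
  induction c generalizing s with
  | skip => rfl
  | ins i => cases i <;> rfl
  | seq c₁ c₂ h₁ h₂ => simp [run, h₁, h₂]
  | ifIdx a b c₁ c₂ h₁ h₂ | ifNum a b c₁ c₂ h₁ h₂ =>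
    simp only [run, h₁, h₂]; exact (apply_ite (fun s : State K => s.atPc p) _ _ _).symm
  | loop r b c h =>
    simp only [run]
    change Nat.rec (motive := fun _ => State K) _ _ (s.idx b) = _
    generalize s.idx b = N
    induction N with
    | zero => rfl
    | succ N ih => simp only [ih, h]; rfl

/-- Compiled programs do what their source says, within the time bound. -/
theorem exists_iterate_step {c : Cmd} (hc : c.WellFormed) {M : Program} {p : ℕ}
    (hM : CodeAt M p (c.code p)) (s : State K) (hs : s.pc = p) :
    ∃ t ≤ c.cost s.idx, (step M)^[t] s = (c.run s).atPc (p + c.len) := by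
  induction c generalizing p s with
  | skip => exact ⟨0, le_rfl, by subst hs; rfl⟩
  | ins i =>
    refine ⟨1, le_rfl, ?_⟩
    rw [Function.iterate_one, hM.step_eq hs]
    subst hs
    cases i <;> first | rfl | simp [WellFormed, Instr.straight] at hc
  | seq c₁ c₂ h₁ h₂ =>
    obtain ⟨t₁, ht₁, e₁⟩ := h₁ hc.1 hM.left s hs
    obtain ⟨t₂, ht₂, e₂⟩ := h₂ hc.2 (hM.right (by simp)) ((c₁.run s).atPc (p + c₁.len)) rfl
    refine ⟨t₂ + t₁, ?_, ?_⟩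
    · have : c₂.cost ((c₁.run s).atPc (p + c₁.len)).idx = c₂.cost s.idx :=
        hc.2.cost_congr fun x hx => hc.1.run_idx s hx
      simp only [cost]
      omega
    · rw [Function.iterate_add_apply, e₁, e₂, run_atPc]
      simp [State.atPc, run, len, add_assoc]
  | ifIdx a b c₁ c₂ h₁ h₂ | ifNum a b c₁ c₂ h₁ h₂ =>
    suffices ∀ R : State K, ((step M s = s.atPc (p + 2 + c₂.len) ∧ R = c₁.run s) ∨
        (step M s = s.atPc (p + 1) ∧ R = c₂.run s)) →
        ∃ t ≤ c₁.cost s.idx + c₂.cost s.idx + 2,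
          (step M)^[t] s = R.atPc (p + (c₁.len + c₂.len + 2)) by
      apply this
      rw [hM.step_eq hs]
      simp only [exec, run]
      split_ifs <;> simp [State.atPc, hs]
    intro R e₀
    have hM₂ := hM.tail rfl
    have hM₁ := hM₂.right (c := p + 1 + c₂.len) (by simp)
    rcases e₀ with ⟨e₀, e₁⟩ | ⟨e₀, e₁⟩
    · obtain ⟨t, ht, e⟩ := h₁ hc.1 (hM₁.tail (by omega)) (s.atPc (p + 2 + c₂.len)) rfl
      refine ⟨t + 1, ?_, ?_⟩
      · simp only [State.atPc] at ht; omega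
      · rw [Function.iterate_succ_apply, e₀, e, run_atPc, e₁]
        simp [State.atPc]; omega
    · obtain ⟨t, ht, e⟩ := h₂ hc.2 hM₂.left (s.atPc (p + 1)) rfl
      refine ⟨1 + (t + 1), ?_, ?_⟩
      · simp only [State.atPc] at ht; omega
      · rw [Function.iterate_add_apply, Function.iterate_succ_apply (step M) t, e₀, e, run_atPc,
          Function.iterate_one, hM₁.step_eq rfl, e₁]
        simp [State.atPc, exec]; omega
  | loop r b c h =>
    obtain ⟨hc, hr, hb, hrc⟩ := hc
    have hM₁ := hM.tail rfl
    have hM₂ := hM₁.tail rfl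
    have hM₃ := hM₂.right (c := p + 2 + c.len) (by simp)
    have hM₄ := hM₃.tail rfl
    have hM₅ := hM₄.tail rfl
    -- the state after `j` rounds
    set S : ℕ → State K := fun j => Nat.rec (motive := fun _ => State K) (s.setIdx r 0)
        (fun j s' => ((c.run s').setIdx 4 1).setIdx r (j + 1)) j with hS
    have hSr : ∀ j, (S j).idx r = j := by
      intro j; cases j <;> simp [hS, State.setIdx]
    have hSx : ∀ j, ∀ x < 4, (S j).idx x = s.idx x := by
      intro j x hx
      induction j with
      | zero => simp [hS, State.setIdx, Function.update_of_ne (show x ≠ r by omega)]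
      | succ j ih =>
        rw [← ih, ← hc.run_idx (S j) hx]
        simp [hS, State.setIdx, Function.update_of_ne (show x ≠ r by omega),
          Function.update_of_ne (show x ≠ 4 by omega)]
    have key : ∀ j ≤ s.idx b, ∃ t ≤ j * (c.cost s.idx + 4) + 1,
        (step M)^[t] s = (S j).atPc (p + 1) := by
      intro j hj
      induction j with
      | zero =>
        refine ⟨1, by omega, ?_⟩
        rw [Function.iterate_one, hM.step_eq hs]
        subst hs; rfl
      | succ j ih =>
        obtain ⟨t, ht, e⟩ := ih (by omega)
        obtain ⟨t', ht', e'⟩ := h hc hM₂.left ((S j).atPc (p + 1 + 1)) rfl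
        have hcost : c.cost ((S j).atPc (p + 1 + 1)).idx = c.cost s.idx :=
          hc.cost_congr (hSx j)
        refine ⟨3 + (t' + (1 + t)), ?_, ?_⟩
        · rw [Nat.succ_mul]; omega
        · have e₁ : step M ((S j).atPc (p + 1)) = (S j).atPc (p + 1 + 1) := by
            rw [hM₁.step_eq rfl]
            have : ¬ s.idx b ≤ j := by omega
            simp [exec, State.atPc, hSr, hSx j b hb, this]
          rw [Function.iterate_add_apply, Function.iterate_add_apply _ t',
            Function.iterate_add_apply _ 1 t, e, Function.iterate_one, e₁, e', run_atPc]
          set s₁ : State K := ((c.run (S j)).atPc (p + 1 + 1)).atPc (p + 1 + 1 + c.len) with hs₁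
          have e₂ : step M s₁ = exec s₁ (.idxConst 4 1) :=
            hM₃.step_eq (by simp [hs₁, State.atPc])
          have e₃ : step M (exec s₁ (.idxConst 4 1)) = _ :=
            hM₄.step_eq (by simp [exec, hs₁, State.atPc])
          have e₄ : step M (exec (exec s₁ (.idxConst 4 1)) (.idxAdd r r 4)) = _ :=
            hM₅.step_eq (by simp [exec, hs₁, State.atPc])
          rw [Function.iterate_succ_apply, Function.iterate_succ_apply, Function.iterate_one,
            e₂, e₃, e₄]
          have hr4 : r ≠ 4 := by omega
          have : (c.run (S j)).idx r = j := by rw [Cmd.run_idx c _ hrc, hSr]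
          have hS' : S (j + 1) = ((c.run (S j)).setIdx 4 1).setIdx r (j + 1) := rfl
          rw [hS']
          simp [exec, hs₁, State.atPc, State.setIdx, hr4, this]
    obtain ⟨t, ht, e⟩ := key _ le_rfl
    refine ⟨1 + t, by simp only [cost]; omega, ?_⟩
    rw [Function.iterate_add_apply, e, Function.iterate_one, hM₁.step_eq rfl]
    have : (s.idx b) ≤ s.idx b := le_rfl
    simp only [exec, State.atPc, hSr, hSx _ b hb, le_refl, if_true, run, len]
    simp [hS]; omega

/-- The rule for loops: an invariant that depends on the counter. -/
theorem run_loop_induction {r b : ℕ} {c : Cmd} {s : State K} (I : ℕ → State K → Prop)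
    (zero : I 0 (s.setIdx r 0))
    (succ : ∀ j < s.idx b, ∀ s', s'.idx r = j → I j s' →
      I (j + 1) (((c.run s').setIdx 4 1).setIdx r (j + 1))) :
    I (s.idx b) ((loop r b c).run s) := by
  simp only [run]
  suffices ∀ j ≤ s.idx b, I j (Nat.rec (motive := fun _ => State K) (s.setIdx r 0)
      (fun j s' => ((c.run s').setIdx 4 1).setIdx r (j + 1)) j) from this _ le_rfl
  intro j hj
  induction j with
  | zero => exact zero
  | succ j ih =>
    refine succ j hj _ ?_ (ih (by omega))
    cases j <;> simp [State.setIdx]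

end Cmd

end NumRAM

/-! ### Running a program as a subroutine -/

namespace NumRAM

variable {K : Type*}

/-- The instruction as part of a subroutine: number arrays are renamed by `β`, everything else by
`α`, the first instruction of the subroutine is moved to position `p`, and instead of stopping the
subroutine goes on at position `e`. -/
def Instr.relocate (α β : ℕ → ℕ) (p e : ℕ) : Instr → Instr
  | .idxConst d k => .idxConst (α d) k
  | .idxAdd d a b => .idxAdd (α d) (α a) (α b)
  | .idxSub d a b => .idxSub (α d) (α a) (α b)
  | .idxLoad d arr i j => .idxLoad (α d) (α arr) (α i) (α j)
  | .idxStore arr i j a => .idxStore (α arr) (α i) (α j) (α a)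
  | .numConst d z => .numConst (α d) z
  | .numAdd d a b => .numAdd (α d) (α a) (α b)
  | .numSub d a b => .numSub (α d) (α a) (α b)
  | .numMul d a b => .numMul (α d) (α a) (α b)
  | .numDiv d a b => .numDiv (α d) (α a) (α b)
  | .numLoad d arr i j => .numLoad (α d) (β arr) (α i) (α j)
  | .numStore arr i j a => .numStore (β arr) (α i) (α j) (α a)
  | .idxJump a b l => .idxJump (α a) (α b) (p + l)
  | .numJump a b l => .numJump (α a) (α b) (p + l)
  | .halt _ => .idxJump 0 0 e

/-- The memory of `s₀` is found in `s` under the names given by `α` and `β`. -/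
structure Embeds (α β : ℕ → ℕ) (s₀ s : State K) : Prop where
  idx : ∀ x, s.idx (α x) = s₀.idx x
  num : ∀ x, s.num (α x) = s₀.num x
  idxArr : ∀ x, s.idxArr (α x) = s₀.idxArr x
  numArr : ∀ x, s.numArr (β x) = s₀.numArr x

/-- The states `s` and `s'` agree on everything that has no name in the ranges of `α` and `β`. -/
structure AgreeOutside (α β : ℕ → ℕ) (s s' : State K) : Prop where
  idx : ∀ x, (∀ y, x ≠ α y) → s'.idx x = s.idx x
  num : ∀ x, (∀ y, x ≠ α y) → s'.num x = s.num x
  idxArr : ∀ x, (∀ y, x ≠ α y) → s'.idxArr x = s.idxArr x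
  numArr : ∀ x, (∀ y, x ≠ β y) → s'.numArr x = s.numArr x

theorem AgreeOutside.refl (α β : ℕ → ℕ) (s : State K) : AgreeOutside α β s s :=
  ⟨fun _ _ => rfl, fun _ _ => rfl, fun _ _ => rfl, fun _ _ => rfl⟩

theorem AgreeOutside.trans {α β : ℕ → ℕ} {s s' s'' : State K} (h : AgreeOutside α β s s')
    (h' : AgreeOutside α β s' s'') : AgreeOutside α β s s'' :=
  ⟨fun x hx => (h'.idx x hx).trans (h.idx x hx), fun x hx => (h'.num x hx).trans (h.num x hx),
    fun x hx => (h'.idxArr x hx).trans (h.idxArr x hx),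
    fun x hx => (h'.numArr x hx).trans (h.numArr x hx)⟩

variable [Field K] [LinearOrder K]

theorem agreeOutside_exec_relocate (α β : ℕ → ℕ) (p e : ℕ) (i : Instr) (s : State K) :
    AgreeOutside α β s (exec s (i.relocate α β p e)) := by
  constructor <;> intro x hx <;> cases i <;> simp [Instr.relocate, exec, hx]

theorem Embeds.exec {α β : ℕ → ℕ} (hα : α.Injective) (hβ : β.Injective) {s₀ s : State K}
    (h : Embeds α β s₀ s) (p e : ℕ) (i : Instr) :
    Embeds α β (exec s₀ i) (exec s (i.relocate α β p e)) := by
  have e₁ : ∀ x y, α x = α y ↔ x = y := fun x y => hα.eq_iff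
  have e₂ : ∀ x y, β x = β y ↔ x = y := fun x y => hβ.eq_iff
  refine ⟨fun x => ?_, fun x => ?_, fun x => ?_, fun x => ?_⟩
  · cases i <;> simp [Instr.relocate, NumRAM.exec, Function.update_apply, e₁, h.idx, h.idxArr]
  · cases i <;> simp [Instr.relocate, NumRAM.exec, Function.update_apply, e₁, h.idx, h.num,
      h.numArr]
  · funext b c
    cases i <;> simp [Instr.relocate, NumRAM.exec, setCell, e₁, h.idx, h.idxArr]
  · funext b c
    cases i <;> simp [Instr.relocate, NumRAM.exec, setCell, e₂, h.idx, h.num, h.numArr]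

theorem pc_exec_relocate {α β : ℕ → ℕ} {s₀ s : State K} (h : Embeds α β s₀ s) {p : ℕ}
    (hp : s.pc = p + s₀.pc) (e : ℕ) {i : Instr} (hi : ∀ ok, i ≠ .halt ok) :
    (exec s (i.relocate α β p e)).pc = p + (exec s₀ i).pc := by
  cases i <;> simp [Instr.relocate, NumRAM.exec, hp, h.idx, h.num, add_assoc] <;>
    first | (split_ifs <;> rfl) | exact absurd rfl (hi _)

/-- If a program stops within `k` steps, then as a subroutine it reaches its exit within
`k + 1` steps, with the same result. -/
theorem exists_iterate_step_relocate {α β : ℕ → ℕ} (hα : α.Injective) (hβ : β.Injective)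
    {P M : Program} {p e : ℕ} (hM : CodeAt M p (P.map (Instr.relocate α β p e))) {k : ℕ}
    {ok : Bool} {s₀ s₀' s : State K} (hk : HaltsWithin P s₀ k ok s₀') (hs : s.pc = p + s₀.pc)
    (h : Embeds α β s₀ s) :
    ∃ t ≤ k + 1, ∃ s', (step M)^[t] s = s' ∧ s'.pc = e ∧ Embeds α β s₀' s' ∧
      AgreeOutside α β s s' := by
  obtain ⟨hk, hok⟩ := hk
  have step_M : ∀ {i} {s₀ s : State K}, s.pc = p + s₀.pc → P[s₀.pc]? = some i →
      step M s = exec s (i.relocate α β p e) := by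
    intro i s₀ s hs hi
    have hl : s₀.pc < P.length := (List.getElem?_eq_some_iff.1 hi).1
    have := hM.get? (i := s₀.pc) (by simpa using hl)
    simp [step, hs, this, hi]
  have halted : ∀ {ok'} {s₀ s : State K}, s.pc = p + s₀.pc → P[s₀.pc]? = some (.halt ok') →
      Embeds α β s₀ s → ∀ k, ∃ t ≤ k + 1, ∃ s', (step M)^[t] s = s' ∧ s'.pc = e ∧
        Embeds α β s₀ s' ∧ AgreeOutside α β s s' := by
    intro ok' s₀ s hs hi h k
    refine ⟨1, by omega, _, rfl, ?_, ?_, ?_⟩ <;>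
      rw [Function.iterate_one, step_M hs hi]
    · simp [Instr.relocate, exec]
    · exact h.exec hα hβ p e (.halt ok')
    · exact agreeOutside_exec_relocate ..
  induction k generalizing s₀ s with
  | zero =>
    subst hk
    exact halted hs hok h 0
  | succ k ih =>
    rw [Function.iterate_succ_apply] at hk
    -- outside the program and at a `halt` the machine stays where it is
    have stuck : step P s₀ = s₀ → s₀' = s₀ := fun hst => by
      rw [hst, Function.iterate_fixed hst] at hk; exact hk.symm
    cases hi : P[s₀.pc]? with
    | none =>
      have := stuck (by simp [step, hi])
      rw [this, hi] at hok
      cases hok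
    | some i =>
      by_cases hh : ∃ ok', i = .halt ok'
      · obtain ⟨ok', rfl⟩ := hh
        have := stuck (by simp [step, hi, exec])
        subst this
        exact halted hs hok h (k + 1)
      · push Not at hh
        have e₀ : step P s₀ = exec s₀ i := by simp [step, hi]
        rw [e₀] at hk
        have e₁ := step_M hs hi
        obtain ⟨t, ht, s', hs', hp, he, ha⟩ := ih
          (pc_exec_relocate h hs e hh) (h.exec hα hβ p e i) hk
        refine ⟨t + 1, by omega, s', ?_, hp, he, (agreeOutside_exec_relocate ..).trans ha⟩
        rw [Function.iterate_succ_apply, e₁, hs']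

end NumRAM

/-! ### Residual reachability -/

namespace MaxFlow

open NumRAM

section Network

variable {V K : Type*} [Fintype V] [Field K]

/-- Outflow minus inflow. -/
def netOut (f : V → V → K) (w : V) : K := ∑ b, f w b - ∑ b, f b w

theorem sum_netOut [DecidableEq V] (f : V → V → K) (S : Finset V) :
    ∑ a ∈ S, netOut f a = ∑ a ∈ S, ∑ b ∈ Sᶜ, f a b - ∑ a ∈ S, ∑ b ∈ Sᶜ, f b a := by
  have h₁ : ∀ a, ∑ b, f a b = ∑ b ∈ S, f a b + ∑ b ∈ Sᶜ, f a b := fun a =>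
    (Finset.sum_add_sum_compl S _).symm
  have h₂ : ∀ a, ∑ b, f b a = ∑ b ∈ S, f b a + ∑ b ∈ Sᶜ, f b a := fun a =>
    (Finset.sum_add_sum_compl S _).symm
  simp only [netOut, h₁, h₂, Finset.sum_sub_distrib, Finset.sum_add_distrib]
  rw [Finset.sum_comm (s := S) (t := S) (f := fun a b => f b a)]
  ring

/-- The value of a flow is the net flow across any cut. -/
theorem netOut_eq_cut [DecidableEq V] {f : V → V → K} {s t : V} {S : Finset V}
    (hf : ∀ w, w ≠ s → w ≠ t → ∑ b, f w b = ∑ b, f b w) (hs : s ∈ S) (ht : t ∉ S) :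
    netOut f s = ∑ a ∈ S, ∑ b ∈ Sᶜ, f a b - ∑ a ∈ S, ∑ b ∈ Sᶜ, f b a := by
  rw [← sum_netOut]
  refine (Finset.sum_eq_single_of_mem s hs fun w hw hws => ?_).symm
  rw [netOut, hf w hws (fun h => ht (h ▸ hw)), sub_self]

theorem netOut_add (f g : V → V → K) (w : V) : netOut (f + g) w = netOut f w + netOut g w := by
  simp only [netOut, Pi.add_apply, Finset.sum_add_distrib]
  ring

theorem netOut_smul (r : K) (f : V → V → K) (w : V) : netOut (r • f) w = r * netOut f w := by
  simp only [netOut, Pi.smul_apply, smul_eq_mul, ← Finset.mul_sum]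
  ring

theorem netOut_single [DecidableEq V] (x y w : V) (r : K) :
    netOut (fun a b => if a = x ∧ b = y then r else 0) w =
      r * ((if w = x then 1 else 0) - (if w = y then 1 else 0)) := by
  simp only [netOut, ite_and, Finset.sum_ite_eq', Finset.mem_univ, if_true]
  split_ifs <;> simp_all

variable [LinearOrder K] [IsStrictOrderedRing K]

/-- A direction that does not decrease empty edges and does not increase full edges can be
followed for some time. -/
theorem exists_pos_feasible {c f d : V → V → K} (h₀ : ∀ a b, 0 ≤ f a b) (h₁ : ∀ a b, f a b ≤ c a b)
    (hd : ∀ a b, (f a b = 0 → 0 ≤ d a b) ∧ (f a b = c a b → d a b ≤ 0)) :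
    ∃ ε : K, 0 < ε ∧ ∀ a b, 0 ≤ (f + ε • d) a b ∧ (f + ε • d) a b ≤ c a b := by
  have key : ∀ e : V × V, ∃ ε : K, 0 < ε ∧ ∀ ε', 0 < ε' → ε' ≤ ε →
      0 ≤ f e.1 e.2 + ε' * d e.1 e.2 ∧ f e.1 e.2 + ε' * d e.1 e.2 ≤ c e.1 e.2 := by
    rintro ⟨a, b⟩
    have hf₀ := h₀ a b
    have hf₁ := h₁ a b
    rcases lt_trichotomy (d a b) 0 with h | h | h
    · have hf : 0 < f a b := lt_of_le_of_ne hf₀ fun e => absurd ((hd a b).1 e.symm) (not_le.2 h)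
      refine ⟨f a b / -d a b, div_pos hf (neg_pos.2 h), fun ε' hp hle => ?_⟩
      rw [le_div_iff₀ (neg_pos.2 h)] at hle
      have := mul_neg_of_pos_of_neg hp h
      constructor <;> simp only <;> linarith
    · exact ⟨1, one_pos, fun ε' _ _ => by simp [h, hf₀, hf₁]⟩
    · have hf : f a b < c a b := lt_of_le_of_ne hf₁ fun e => absurd ((hd a b).2 e) (not_le.2 h)
      refine ⟨(c a b - f a b) / d a b, div_pos (sub_pos.2 hf) h, fun ε' hp hle => ?_⟩
      rw [le_div_iff₀ h] at hle
      have := mul_pos hp h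
      constructor <;> simp only <;> linarith
  choose ε hε hε' using key
  cases isEmpty_or_nonempty V with
  | inl hV => exact ⟨1, one_pos, fun a => hV.elim a⟩
  | inr hV =>
    obtain ⟨e₀, he₀⟩ := Finite.exists_min ε
    exact ⟨ε e₀, hε e₀, fun a b => hε' (a, b) _ (hε e₀) (he₀ _)⟩

/-- The nodes that can be reached from `s` in the residual graph of a maximum flow form a cut that
is crossed forwards by full edges and backwards by empty edges only. -/
theorem exists_saturated_cut [DecidableEq V] {c f : V → V → K} {s t : V} (hst : s ≠ t)
    (h₀ : ∀ a b, 0 ≤ f a b) (h₁ : ∀ a b, f a b ≤ c a b) (hf : ∀ w, w ≠ s → w ≠ t → netOut f w = 0)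
    (hmax : ∀ g : V → V → K, (∀ a b, 0 ≤ g a b) → (∀ a b, g a b ≤ c a b) →
      (∀ w, w ≠ s → w ≠ t → netOut g w = 0) → netOut g s ≤ netOut f s) :
    ∃ S : Finset V, s ∈ S ∧ t ∉ S ∧ ∀ a ∈ S, ∀ b ∉ S, f a b = c a b ∧ f b a = 0 := by
  classical
  let R : V → V → Prop := fun a b => f a b < c a b ∨ 0 < f b a
  -- every reachable node is the end of a feasible direction of value one
  have dir : ∀ x, Relation.ReflTransGen R s x → ∃ d : V → V → K,
      (∀ a b, (f a b = 0 → 0 ≤ d a b) ∧ (f a b = c a b → d a b ≤ 0)) ∧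
      ∀ w, netOut d w = (if w = s then 1 else 0) - (if w = x then 1 else 0) := by
    intro x hx
    induction hx with
    | refl => exact ⟨0, fun a b => by simp, fun w => by simp [netOut]⟩
    | @tail x y _ hxy ih =>
      obtain ⟨d, hd, hd'⟩ := ih
      rcases hxy with hxy | hxy
      · refine ⟨d + fun a b => if a = x ∧ b = y then 1 else 0,
          fun a b => ⟨fun h => ?_, fun h => ?_⟩, fun w => ?_⟩
        · exact add_nonneg ((hd a b).1 h) (by dsimp only; split_ifs <;> simp)
        · have : ¬ (a = x ∧ b = y) := by rintro ⟨rfl, rfl⟩; exact hxy.ne h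
          simpa [this] using (hd a b).2 h
        · rw [netOut_add, hd', netOut_single]; ring
      · refine ⟨d + fun a b => if a = y ∧ b = x then -1 else 0,
          fun a b => ⟨fun h => ?_, fun h => ?_⟩, fun w => ?_⟩
        · have : ¬ (a = y ∧ b = x) := by rintro ⟨rfl, rfl⟩; exact hxy.ne' h
          simpa [this] using (hd a b).1 h
        · exact add_nonpos ((hd a b).2 h) (by dsimp only; split_ifs <;> simp)
        · rw [netOut_add, hd', netOut_single]; ring
  refine ⟨Finset.univ.filter fun x => Relation.ReflTransGen R s x, ?_, ?_, ?_⟩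
  · simp [Relation.ReflTransGen.refl]
  · simp only [Finset.mem_filter, Finset.mem_univ, true_and]
    intro ht
    obtain ⟨d, hd, hd'⟩ := dir t ht
    obtain ⟨ε, hε, hfd⟩ := exists_pos_feasible h₀ h₁ hd
    have := hmax (f + ε • d) (fun a b => (hfd a b).1) (fun a b => (hfd a b).2)
      (fun w hs ht => by simp [netOut_add, netOut_smul, hd', hf w hs ht, hs, ht])
    rw [netOut_add, netOut_smul, hd', if_pos rfl, if_neg hst] at this
    linarith
  · simp only [Finset.mem_filter, Finset.mem_univ, true_and]
    intro a ha b hb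
    have : ¬ R a b := fun h => hb (ha.tail h)
    simp only [R, not_or, not_lt] at this
    exact ⟨le_antisymm (h₁ a b) this.1, le_antisymm this.2 (h₀ b a)⟩

end Network

/-! ### Cuts in graphs with capacities on edges or nodes -/

variable {K : Type*} [Field K] [LinearOrder K] {n : ℕ}

/-- `S` contains `s` but not `t`; moreover, if the capacities are on the nodes, no edge leads
from `S` to `t`. -/
def CapGraph.IsCut (G : CapGraph K n) (s t : Fin n) (S : Finset (Fin n)) : Prop :=
  s ∈ S ∧ t ∉ S ∧
    match G with
    | .edgeCap _ _ => True
    | .nodeCap adj _ _ => ∀ a ∈ S, ¬ adj a t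

/-- The capacity of a cut: of the edges leaving `S`, or of the nodes outside `S` that are heads of
such edges. -/
def CapGraph.cutCap (G : CapGraph K n) (S : Finset (Fin n)) : K :=
  match G with
  | .edgeCap c _ => ∑ b ∈ Sᶜ, ∑ a ∈ S, c a b
  | .nodeCap adj c _ => ∑ b ∈ Sᶜ with ∃ a ∈ S, adj a b, c b

variable [IsStrictOrderedRing K]

/-- Weak duality. -/
theorem IsFlow.val_le_cutCap {G : CapGraph K n} {s t : Fin n} {f : Fin n → Fin n → K}
    (hf : IsFlow G s t f) {S : Finset (Fin n)} (hS : G.IsCut s t S) : val s f ≤ G.cutCap S := by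
  obtain ⟨hs, ht, hS⟩ := hS
  have h := netOut_eq_cut hf.conservation hs ht
  have hback : 0 ≤ ∑ a ∈ S, ∑ b ∈ Sᶜ, f b a :=
    Finset.sum_nonneg fun a _ => Finset.sum_nonneg fun b _ => hf.nonneg b a
  have hle : val s f ≤ ∑ b ∈ Sᶜ, ∑ a ∈ S, f a b := by
    rw [Finset.sum_comm]; change netOut f s ≤ _; linarith
  refine hle.trans ?_
  have hr := hf.respects
  cases G with
  | edgeCap c hc => exact Finset.sum_le_sum fun b _ => Finset.sum_le_sum fun a _ => hr a b
  | nodeCap adj c hc =>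
    simp only [CapGraph.cutCap]
    rw [Finset.sum_filter]
    refine Finset.sum_le_sum fun b hb => ?_
    split_ifs with hab
    · obtain ⟨a, ha, hab⟩ := hab
      have hbs : b ≠ s := fun h => Finset.mem_compl.1 hb (h ▸ hs)
      have hbt : b ≠ t := fun h => hS a ha (h ▸ hab)
      calc ∑ a ∈ S, f a b ≤ ∑ a, f a b :=
            Finset.sum_le_univ_sum_of_nonneg fun a => hf.nonneg a b
        _ = ∑ a, f b a := (hf.conservation b hbs hbt).symm
        _ ≤ c b := hr.2 b hbs hbt
    · refine (Finset.sum_eq_zero fun a ha => ?_).le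
      by_contra h
      exact hab ⟨a, ha, hr.1 a b h⟩

/-- The flow through the node `w`: inflow for the source, outflow for the other nodes. -/
def through (s : Fin n) (f : Fin n → Fin n → K) (w : Fin n) : K :=
  if w = s then ∑ b, f b w else ∑ b, f w b

/-- Splitting each node `w` into an entry `(w, false)` and an exit `(w, true)`: the weights `f` are
put on edges from exits to entries, the weights `h` on edges from the entry to the exit of the
same node. -/
def splitWeight (f : Fin n → Fin n → K) (h : Fin n → K) : Fin n × Bool → Fin n × Bool → K
  | (a, true), (b, false) => f a b
  | (a, false), (b, true) => if a = b then h a else 0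
  | _, _ => 0

omit [LinearOrder K] [IsStrictOrderedRing K] in
theorem netOut_splitWeight_exit (f : Fin n → Fin n → K) (h : Fin n → K) (w : Fin n) :
    netOut (splitWeight f h) (w, true) = ∑ b, f w b - h w := by
  simp [netOut, Fintype.sum_prod_type, splitWeight]

omit [LinearOrder K] [IsStrictOrderedRing K] in
theorem netOut_splitWeight_entry (f : Fin n → Fin n → K) (h : Fin n → K) (w : Fin n) :
    netOut (splitWeight f h) (w, false) = h w - ∑ b, f b w := by
  simp [netOut, Fintype.sum_prod_type, splitWeight]

/-- Strong duality: for every maximum flow there is a cut whose capacity is the value of the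
flow. -/
theorem exists_cut_of_isMaxFlow {G : CapGraph K n} {s t : Fin n} (hst : s ≠ t)
    {f : Fin n → Fin n → K} (hf : IsMaxFlow G s t f) :
    ∃ S, G.IsCut s t S ∧ val s f = G.cutCap S := by
  classical
  obtain ⟨hf, hmax⟩ := hf
  have hr := hf.respects
  cases G with
  | edgeCap c hc =>
    obtain ⟨S, hs, ht, hS⟩ := exists_saturated_cut hst hf.nonneg hr
      (fun w hws hwt => sub_eq_zero.2 (hf.conservation w hws hwt))
      (fun g h₀ h₁ h₂ => hmax g ⟨h₀, h₁, fun w hws hwt => sub_eq_zero.1 (h₂ w hws hwt)⟩)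
    refine ⟨S, ⟨hs, ht, trivial⟩, ?_⟩
    change netOut f s = _
    rw [netOut_eq_cut hf.conservation hs ht, CapGraph.cutCap, Finset.sum_comm (s := Sᶜ)]
    rw [Finset.sum_eq_zero (s := S) (f := fun a => ∑ b ∈ Sᶜ, f b a), sub_zero]
    · exact Finset.sum_congr rfl fun a ha => Finset.sum_congr rfl fun b hb =>
        (hS a ha b (Finset.mem_compl.1 hb)).1
    · exact fun a ha => Finset.sum_eq_zero fun b hb => (hS a ha b (Finset.mem_compl.1 hb)).2
  | nodeCap adj c hc =>
    -- Edges of unbounded capacity get a capacity that exceeds the flow; thus no such edge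
    -- leaves a saturated cut.
    let c' := splitWeight (fun a b => if adj a b then f a b + 1 else 0)
      (fun w => if w = s ∨ w = t then through s f w + 1 else c w)
    let f' := splitWeight f (through s f)
    have hthr : ∀ w, 0 ≤ through s f w := fun w => by
      unfold through
      split_ifs
      · exact Finset.sum_nonneg fun b _ => hf.nonneg b w
      · exact Finset.sum_nonneg fun b _ => hf.nonneg w b
    have h₀ : ∀ x y, 0 ≤ f' x y := by
      rintro ⟨a, _ | _⟩ ⟨b, _ | _⟩ <;> simp only [f', splitWeight, le_refl, hf.nonneg]
      split_ifs <;> simp [hthr]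
    have h₁ : ∀ x y, f' x y ≤ c' x y := by
      rintro ⟨a, _ | _⟩ ⟨b, _ | _⟩ <;> simp only [f', c', splitWeight, le_refl]
      · by_cases hab : a = b
        · simp only [hab, if_true]
          split_ifs with h
          · linarith
          · push Not at h
            simpa [through, h.1] using hr.2 b h.1 h.2
        · simp [hab]
      · split_ifs with h
        · linarith
        · by_contra h'
          exact h (hr.1 a b fun e => h' e.le)
    have hcons : ∀ x, x ≠ (s, true) → x ≠ (t, false) → netOut f' x = 0 := by
      rintro ⟨w, _ | _⟩ hs ht
      · rw [netOut_splitWeight_entry]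
        by_cases hws : w = s
        · simp [through, hws]
        · have hwt : w ≠ t := fun e => ht (by rw [e])
          simp [through, hws, hf.conservation w hws hwt]
      · have hws : w ≠ s := fun e => hs (by rw [e])
        rw [netOut_splitWeight_exit]
        simp [through, hws]
    have hval : netOut f' (s, true) = val s f := by
      rw [netOut_splitWeight_exit]; simp [through, val]
    obtain ⟨S, hs, ht, hS⟩ := exists_saturated_cut (s := (s, true)) (t := (t, false))
      (by simp) h₀ h₁ hcons (by
        intro g hg₀ hg₁ hg₂
        have hg : ∀ x y, c' x y = 0 → g x y = 0 := fun x y h =>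
          le_antisymm ((hg₁ x y).trans h.le) (hg₀ x y)
        have hgs : g = splitWeight (fun a b => g (a, true) (b, false))
            (fun a => g (a, false) (a, true)) := by
          funext ⟨a, i⟩ ⟨b, j⟩
          cases i <;> cases j <;> simp only [splitWeight]
          · exact hg _ _ rfl
          · split_ifs with h
            · rw [h]
            · exact hg _ _ (by simp [c', splitWeight, h])
          · exact hg _ _ rfl
        have hexit : ∀ w, w ≠ s → ∑ b, g (w, true) (b, false) = g (w, false) (w, true) := by
          intro w hw
          have := hg₂ (w, true) (by simp [hw]) (by simp)
          rw [hgs, netOut_splitWeight_exit] at this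
          exact sub_eq_zero.1 this
        have hentry : ∀ w, w ≠ t → g (w, false) (w, true) = ∑ b, g (b, true) (w, false) := by
          intro w hw
          have := hg₂ (w, false) (by simp) (by simp [hw])
          rw [hgs, netOut_splitWeight_entry] at this
          exact sub_eq_zero.1 this
        rw [hval]
        refine le_of_eq_of_le ?_ (hmax (fun a b => g (a, true) (b, false))
          ⟨fun a b => hg₀ _ _, ⟨fun a b h => ?_, fun w hws hwt => ?_⟩, fun w hws hwt => ?_⟩)
        · have := netOut_splitWeight_exit (fun a b => g (a, true) (b, false))
            (fun a => g (a, false) (a, true)) s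
          rw [← hgs] at this
          rw [this, val, hentry s hst]
        · by_contra hab
          exact h (hg _ _ (by simp [c', splitWeight, hab]))
        · rw [hexit w hws]
          simpa [c', splitWeight, hws, hwt] using hg₁ (w, false) (w, true)
        · rw [hexit w hws, hentry w hwt])
    -- the nodes whose exit belongs to the cut
    set Y : Finset (Fin n) := Finset.univ.filter fun w => (w, true) ∈ S ∧ w ≠ t with hY
    have hsY : s ∈ Y := by simp [hY, hs, hst]
    have htY : t ∉ Y := by simp [hY]
    have hentryS : ∀ a ∈ Y, ∀ b, adj a b → (b, false) ∈ S := by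
      intro a ha b hab
      by_contra hb
      have := (hS (a, true) (by simp_all) (b, false) hb).1
      simp [f', c', splitWeight, hab] at this
    refine ⟨Y, ⟨hsY, htY, fun a ha hat => ht (hentryS a ha t hat)⟩, ?_⟩
    -- no flow enters an entry in the cut from a node outside `Y`
    have hin : ∀ a ∉ Y, ∀ b, (b, false) ∈ S → f a b = 0 := by
      intro a ha b hb
      by_cases haS : (a, true) ∈ S
      · have hat : a = t := by by_contra h; exact ha (by simp [hY, haS, h])
        subst hat
        have := (hS (a, true) haS (a, false) ht).2
        simp only [f', splitWeight, if_true, through, if_neg hst.symm] at this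
        exact (Finset.sum_eq_zero_iff_of_nonneg fun b _ => hf.nonneg a b).1 this b
          (Finset.mem_univ b)
      · exact (hS (b, false) hb (a, true) haS).2
    have hback : ∀ b ∈ Y, ∀ a ∈ Yᶜ, f a b = 0 := by
      intro b hb a ha
      by_cases hbS : (b, false) ∈ S
      · exact hin a (Finset.mem_compl.1 ha) b hbS
      · have hb' : (b, true) ∈ S ∧ b ≠ t := by simpa [hY] using hb
        have := (hS (b, true) hb'.1 (b, false) hbS).2
        have hsum : ∑ a, f a b = 0 := by
          simp only [f', splitWeight, if_true, through] at this
          split_ifs at this with h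
          · exact this
          · rwa [← hf.conservation b h hb'.2]
        exact (Finset.sum_eq_zero_iff_of_nonneg fun a _ => hf.nonneg a b).1 hsum a
          (Finset.mem_univ a)
    change netOut f s = _
    rw [netOut_eq_cut hf.conservation hsY htY, CapGraph.cutCap, Finset.sum_comm,
      Finset.sum_eq_zero (s := Y) (f := fun a => ∑ b ∈ Yᶜ, f b a), sub_zero, Finset.sum_filter]
    · refine Finset.sum_congr rfl fun b hb => ?_
      split_ifs with hab
      · obtain ⟨a, ha, hab⟩ := hab
        have hbS := hentryS a ha b hab
        have hbs : b ≠ s := fun h => Finset.mem_compl.1 hb (h ▸ hsY)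
        have hbt : b ≠ t := fun h => ht (h ▸ hbS)
        have hbS' : (b, true) ∉ S := fun h => Finset.mem_compl.1 hb (by simp [hY, h, hbt])
        have := (hS (b, false) hbS (b, true) hbS').1
        simp only [f', c', splitWeight, if_true, through, hbs, hbt, or_self,
          if_false] at this
        rw [← this, hf.conservation b hbs hbt, ← Finset.sum_add_sum_compl Y fun a => f a b,
          Finset.sum_eq_zero (s := Yᶜ) fun a ha => hin a (Finset.mem_compl.1 ha) b hbS, add_zero]
      · refine Finset.sum_eq_zero fun a ha => ?_
        by_contra h
        exact hab ⟨a, ha, hr.1 a b h⟩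
    · exact fun b hb => Finset.sum_eq_zero fun a ha => hback b hb a ha

end MaxFlow

/-! ### The program: preparation of the guess -/

namespace MaxFlow

open NumRAM NumRAM.Cmd

variable {K : Type*} [Field K] [LinearOrder K]

/-- Index register `5` is nonzero as soon as some test has failed. -/
def failCmd : Cmd := ins (.idxConst 5 1)

/-- Test whether index register `a` ≤ index register `b`. -/
def testIdx (a b : ℕ) : Cmd := ifIdx a b skip failCmd

/-- Test whether number register `a` ≤ number register `b`. -/
def testNum (a b : ℕ) : Cmd := ifNum a b skip failCmd

open Classical in
/-- Record the outcome of a test. -/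
noncomputable def record (s : State K) (φ : Prop) : State K :=
  { s with idx := Function.update s.idx 5 (if φ then s.idx 5 else 1) }

omit [Field K] [LinearOrder K] in
theorem record_true (s : State K) : record s True = s := by simp [record]

theorem run_failCmd (s : State K) : failCmd.run s = record s False := by
  simp [failCmd, Cmd.run, exec, record]

theorem run_ins (i : Instr) (s : State K) : (ins i).run s = { exec s i with pc := s.pc } := rfl

theorem run_seq (c₁ c₂ : Cmd) (s : State K) : (c₁ ;; c₂).run s = c₂.run (c₁.run s) := rfl

omit [Field K] [LinearOrder K] in
theorem record_record (s : State K) (φ ψ : Prop) : record (record s φ) ψ = record s (φ ∧ ψ) := by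
  by_cases h : φ <;> by_cases h' : ψ <;> simp [record, h, h']

theorem run_testIdx (a b : ℕ) (s : State K) :
    (testIdx a b).run s = record s (s.idx a ≤ s.idx b) := by
  simp only [testIdx, Cmd.run]
  split_ifs with h <;> simp [h, record_true, run_failCmd]

theorem run_testNum (a b : ℕ) (s : State K) :
    (testNum a b).run s = record s (s.num a ≤ s.num b) := by
  simp only [testNum, Cmd.run]
  split_ifs with h <;> simp [h, record_true, run_failCmd]

omit [Field K] [LinearOrder K] in
theorem record_flag (s : State K) (φ : Prop) :
    (record s φ).idx 5 = 0 ↔ s.idx 5 = 0 ∧ φ := by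
  by_cases h : φ <;> simp [record, h]

omit [Field K] [LinearOrder K] in
theorem record_idx (s : State K) (φ : Prop) {x : ℕ} (hx : x ≠ 5) :
    (record s φ).idx x = s.idx x := by
  simp [record, hx]

/-- The input of `s₀` is untouched in `s`, and some registers hold constants.

The index registers of the program are: `0` to `3` input, `4` increment of loop counters, `5` flag,
`6`, `7`, `8` the constants `0`, `1`, `2`, `9` running offset, `10`, `11`, `12` counters for pairs,
nodes and entries of the guess, `13` to `17` temporary values.  Index array `5` is the table of
offsets.  Number arrays `5`, `6`, `7` hold the flows, the net outflows and the outflows; the names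
from `100` on belong to the subroutine, which finds the matrix of the cuts in array `100` and leaves
the product in array `102`. -/
structure Ready (s₀ s : State K) : Prop where
  idx : ∀ x < 4, s.idx x = s₀.idx x
  zero : s.idx 6 = 0
  one : s.idx 7 = 1
  two : s.idx 8 = 2
  num_zero : s.num 0 = 0
  num_one : s.num 1 = 1
  idxArr : ∀ x < 2, s.idxArr x = s₀.idxArr x
  numArr : ∀ x < 3, s.numArr x = s₀.numArr x

/-- The program keeps `Ready` true. -/
def KeepsReady (c : Cmd) : Prop :=
  (∀ x ∈ c.idxWrites, x = 4 ∨ x = 5 ∨ 9 ≤ x) ∧ (∀ x ∈ c.numWrites, 2 ≤ x) ∧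
    (∀ x ∈ c.idxArrWrites, 2 ≤ x) ∧ ∀ x ∈ c.numArrWrites, 3 ≤ x

theorem Ready.run {s₀ s : State K} (h : Ready s₀ s) {c : Cmd} (hc : KeepsReady c) :
    Ready s₀ (c.run s) := by
  obtain ⟨h₁, h₂, h₃, h₄⟩ := hc
  have k₁ : ∀ x, x < 4 ∨ x = 6 ∨ x = 7 ∨ x = 8 → (c.run s).idx x = s.idx x := fun x hx =>
    run_idx c s fun hm => by have := h₁ x hm; omega
  have k₂ : ∀ x < 2, (c.run s).num x = s.num x := fun x hx =>
    run_num c s fun hm => by have := h₂ x hm; omega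
  exact ⟨fun x hx => (k₁ x (by omega)).trans (h.idx x hx), (k₁ 6 (by omega)).trans h.zero,
    (k₁ 7 (by omega)).trans h.one, (k₁ 8 (by omega)).trans h.two,
    (k₂ 0 (by omega)).trans h.num_zero, (k₂ 1 (by omega)).trans h.num_one,
    fun x hx => (run_idxArr c s fun hm => by have := h₃ x hm; omega).trans (h.idxArr x hx),
    fun x hx => (run_numArr c s fun hm => by have := h₄ x hm; omega).trans (h.numArr x hx)⟩

omit [LinearOrder K] in
theorem Ready.setIdx {s₀ s : State K} (h : Ready s₀ s) {r : ℕ} (hr : r = 4 ∨ 9 ≤ r) (v : ℕ) :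
    Ready s₀ (s.setIdx r v) := by
  have k : ∀ x, x < 4 ∨ x = 6 ∨ x = 7 ∨ x = 8 → (s.setIdx r v).idx x = s.idx x := fun x hx => by
    simp [State.setIdx, Function.update_of_ne (show x ≠ r by omega)]
  exact ⟨fun x hx => (k x (by omega)).trans (h.idx x hx), (k 6 (by omega)).trans h.zero,
    (k 7 (by omega)).trans h.one, (k 8 (by omega)).trans h.two, h.num_zero, h.num_one, h.idxArr,
    h.numArr⟩

/-- Enter node `w` (register `11`) of the cut of pair `i` (register `10`). -/
def markNode : Cmd :=
  ins (.idxAdd 13 11 7) ;; ins (.numLoad 2 2 10 13) ;; ifNum 2 0 skip (ins (.numStore 100 10 11 1))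

/-- Note the offset of pair `i`, and enter its cut. -/
def markPair : Cmd := ins (.idxStore 5 10 6 9) ;; ins (.idxAdd 9 9 0) ;; loop 11 0 markNode

/-- Constants, the table of offsets `i * n`, and the `0`-`1` matrix of the guessed cuts. -/
def prepare : Cmd :=
  ins (.idxConst 7 1) ;; ins (.idxConst 8 2) ;; ins (.numConst 1 1) ;; loop 10 1 markPair

theorem keepsReady_markNode : KeepsReady markNode := by
  simp [KeepsReady, markNode, idxWrites, numWrites, idxArrWrites, numArrWrites, writes,
    Instr.idxWrites, Instr.numWrites, Instr.idxArrWrites, Instr.numArrWrites]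

theorem run_markNode_numArr {s₀ s : State K} (h : Ready s₀ s) {i w : ℕ} (hi : s.idx 10 = i)
    (hw : s.idx 11 = w) : (markNode.run s).numArr 100 = fun a b =>
      if (a = i ∧ b = w) ∧ 0 < s₀.numArr 2 a (b + 1) then 1 else s.numArr 100 a b := by
  have e : s.numArr 2 = s₀.numArr 2 := h.numArr 2 (by omega)
  simp only [markNode, Cmd.run, exec]
  funext a b
  by_cases hx : s₀.numArr 2 i (w + 1) ≤ 0
  · have : ¬ ((a = i ∧ b = w) ∧ 0 < s₀.numArr 2 a (b + 1)) := by
      rintro ⟨⟨rfl, rfl⟩, h⟩; exact not_lt.2 hx h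
    simp [h.num_zero, h.one, e, hi, hw, hx, this]
  · have : ((a = i ∧ b = w) ∧ 0 < s₀.numArr 2 a (b + 1)) ↔ a = i ∧ b = w :=
      ⟨And.left, fun h => ⟨h, by rw [h.1, h.2]; exact not_le.1 hx⟩⟩
    simp [h.num_zero, h.num_one, h.one, e, hi, hw, hx, this]

/-- What `prepare` computes: the table of offsets and the matrix of the guessed cuts. -/
theorem run_prepare {s₀ : State K} (h6 : s₀.idx 6 = 0) (h9 : s₀.idx 9 = 0)
    (h0 : s₀.num 0 = 0) (h5 : s₀.idxArr 5 = fun _ _ => 0) (h100 : s₀.numArr 100 = fun _ _ => 0) :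
    Ready s₀ (prepare.run s₀) ∧
    ((prepare.run s₀).idxArr 5 = fun a b => if a < s₀.idx 1 ∧ b = 0 then a * s₀.idx 0 else 0) ∧
    (prepare.run s₀).numArr 100 = fun a b =>
      if (a < s₀.idx 1 ∧ b < s₀.idx 0) ∧ 0 < s₀.numArr 2 a (b + 1) then 1 else 0 := by
  set n := s₀.idx 0 with hn
  set q := s₀.idx 1 with hq
  simp only [prepare, run_seq]
  set s₁ := (ins (.numConst 1 1)).run ((ins (.idxConst 8 2)).run ((ins (.idxConst 7 1)).run s₀))
    with hs₁
  have r₁ : Ready s₀ s₁ := by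
    constructor
    · intro x hx
      simp [hs₁, Cmd.run, exec, Function.update_of_ne (show x ≠ 8 by omega),
        Function.update_of_ne (show x ≠ 7 by omega)]
    all_goals simp [hs₁, Cmd.run, exec, h6, h0]
  have e₁ : s₁.idx 1 = q := r₁.idx 1 (by omega)
  have main := run_loop_induction (r := 10) (b := 1) (c := markPair) (s := s₁)
    (fun i s => Ready s₀ s ∧ s.idx 9 = i * n ∧
      (s.idxArr 5 = fun a b => if a < i ∧ b = 0 then a * n else 0) ∧
      s.numArr 100 = fun a b => if (a < i ∧ b < n) ∧ 0 < s₀.numArr 2 a (b + 1) then 1 else 0)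
    ⟨r₁.setIdx (by omega) _, by simp [State.setIdx, hs₁, Cmd.run, exec, h9],
      by simp [State.setIdx, hs₁, Cmd.run, exec, h5],
      by simp [State.setIdx, hs₁, Cmd.run, exec, h100]⟩ ?_
  · rw [e₁] at main
    exact ⟨main.1, main.2.2.1, main.2.2.2⟩
  · rintro i - s hi ⟨r, h9, h5, h100⟩
    set s₂ := (ins (.idxAdd 9 9 0)).run ((ins (.idxStore 5 10 6 9)).run s) with hs₂
    have r₂ : Ready s₀ s₂ := by
      have : KeepsReady (ins (.idxStore 5 10 6 9) ;; ins (.idxAdd 9 9 0)) := by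
        simp [KeepsReady, idxWrites, numWrites, idxArrWrites, numArrWrites, writes,
          Instr.idxWrites, Instr.numWrites, Instr.idxArrWrites, Instr.numArrWrites]
      exact r.run this
    have e₂ : s₂.idx 0 = n := r₂.idx 0 (by omega)
    -- within row `i`, the first `w` nodes have been entered
    have inner := run_loop_induction (r := 11) (b := 0) (c := markNode) (s := s₂)
      (fun w s => Ready s₀ s ∧ s.idx 10 = i ∧ s.numArr 100 = fun a b =>
        if (a < i ∧ b < n ∨ a = i ∧ b < w) ∧ 0 < s₀.numArr 2 a (b + 1) then 1 else 0)
      ⟨r₂.setIdx (by omega) _, by simp [State.setIdx, hs₂, Cmd.run, exec, hi],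
        by simp [State.setIdx, hs₂, Cmd.run, exec, h100]⟩ ?_
    · rw [e₂] at inner
      have hrun : markPair.run s = (loop 11 0 markNode).run s₂ := rfl
      refine ⟨((hrun ▸ inner.1).setIdx (by omega) _).setIdx (by omega) _, ?_, ?_, ?_⟩
      · change Function.update (Function.update (markPair.run s).idx 4 1) 10 (i + 1) 9 = _
        rw [hrun]
        simp only [ne_eq, Nat.reduceEqDiff, not_false_eq_true, Function.update_of_ne]
        rw [run_idx _ _ (by simp [markNode, idxWrites, writes, Instr.idxWrites])]
        simp [hs₂, Cmd.run, exec, h9, r.idx 0, ← hn, Nat.succ_mul]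
      · change (markPair.run s).idxArr 5 = _
        rw [hrun, run_idxArr _ _ (by simp [markNode, idxArrWrites, writes, Instr.idxArrWrites])]
        funext a b
        simp only [hs₂, Cmd.run, exec, setCell_self, hi, r.zero, h9, h5]
        by_cases ha : a = i <;> by_cases hb : b = 0 <;> simp [ha, hb]
        have : a < i ↔ a < i + 1 := by omega
        simp [this]
      · change (markPair.run s).numArr 100 = _
        rw [hrun, inner.2.2]
        funext a b
        have : (a < i ∧ b < n ∨ a = i ∧ b < n) ↔ a < i + 1 ∧ b < n := by omega
        simp only [this]
    · rintro w - s' hw ⟨r', hi', h100'⟩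
      refine ⟨((r'.run keepsReady_markNode).setIdx (by omega) _).setIdx (by omega) _, ?_, ?_⟩
      · change Function.update (Function.update (markNode.run s').idx 4 1) 11 (w + 1) 10 = _
        simp only [ne_eq, Nat.reduceEqDiff, not_false_eq_true, Function.update_of_ne]
        rw [run_idx _ _ (by simp [markNode, idxWrites, writes, Instr.idxWrites]), hi']
      · change (markNode.run s').numArr 100 = _
        rw [run_markNode_numArr r' hi' hw, h100']
        funext a b
        have : (a < i ∧ b < n ∨ a = i ∧ b < w + 1) ↔
          (a = i ∧ b = w) ∨ (a < i ∧ b < n ∨ a = i ∧ b < w) := by omega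
        by_cases h₁ : (a = i ∧ b = w) ∧ 0 < s₀.numArr 2 a (b + 1)
        · rw [if_pos h₁, if_pos ⟨this.2 (Or.inl h₁.1), h₁.2⟩]
        · rw [if_neg h₁]
          refine if_congr ?_ rfl rfl
          rw [this]
          exact ⟨fun h => ⟨.inr h.1, h.2⟩, fun h => ⟨h.1.resolve_left fun h' => h₁ ⟨h', h.2⟩, h.2⟩⟩

end MaxFlow

/-! ### The program: reading the flows -/

namespace MaxFlow

open NumRAM NumRAM.Cmd

variable {K : Type*} [Field K] [LinearOrder K]

/-- The sum of the first `m` numbers `x k`, sorted into cells. -/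
def tally (cell : ℕ → ℕ × ℕ) (x : ℕ → K) (m : ℕ) (r c : ℕ) : K :=
  ∑ k ∈ Finset.range m, if cell k = (r, c) then x k else 0

omit [LinearOrder K] in
theorem tally_succ (cell : ℕ → ℕ × ℕ) (x : ℕ → K) (m r c : ℕ) :
    tally cell x (m + 1) r c = tally cell x m r c + if cell m = (r, c) then x m else 0 :=
  Finset.sum_range_succ _ _

/-- The test on entry `(i, a, b, x)` of the guess, if `f` is the flow for pair `i` on the edge
`(a, b)` up to this entry and `w` is the weight of this edge. -/
def EntryTest (n q kind i a b : ℕ) (x f w : K) : Prop :=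
  i < q ∧ a < n ∧ b < n ∧ 0 ≤ x ∧ if kind = 0 then f ≤ w else (w ≤ 0 → x ≤ 0)

/-- Load entry `e` (register `12`) of the guess. -/
def loadEntry : Cmd :=
  ins (.idxLoad 13 1 12 6) ;; ins (.idxLoad 14 1 12 7) ;; ins (.idxLoad 15 1 12 8) ;;
  ins (.numLoad 2 2 12 6)

/-- Test the range of the entry. -/
def testEntry : Cmd :=
  ins (.idxAdd 16 13 7) ;; testIdx 16 1 ;; ins (.idxAdd 16 14 7) ;; testIdx 16 0 ;;
  ins (.idxAdd 16 15 7) ;; testIdx 16 0 ;; testNum 0 2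

/-- Add the entry to the flow, to the net outflows of its ends, and to the outflow of its tail. -/
def addEntry : Cmd :=
  ins (.idxLoad 16 5 13 6) ;; ins (.idxAdd 16 16 14) ;;
  ins (.numLoad 3 5 16 15) ;; ins (.numAdd 3 3 2) ;; ins (.numStore 5 16 15 3) ;;
  ins (.numLoad 4 6 13 14) ;; ins (.numAdd 4 4 2) ;; ins (.numStore 6 13 14 4) ;;
  ins (.numLoad 4 6 13 15) ;; ins (.numSub 4 4 2) ;; ins (.numStore 6 13 15 4) ;;
  ins (.numLoad 4 7 13 14) ;; ins (.numAdd 4 4 2) ;; ins (.numStore 7 13 14 4) ;;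
  ins (.numLoad 4 0 14 15)

/-- Test the weight of the edge. -/
def testWeight : Cmd := ifIdx 3 6 (testNum 3 4) (ifNum 4 0 (testNum 2 0) skip)

/-- Process entry `e` (register `12`) of the guess. -/
def readEntry : Cmd := loadEntry ;; testEntry ;; addEntry ;; testWeight

/-- Read the flows. -/
def readFlows : Cmd := loop 12 2 readEntry

theorem keepsReady_readEntry : KeepsReady readEntry := by
  simp [KeepsReady, readEntry, loadEntry, testEntry, addEntry, testWeight, testIdx, testNum,
    failCmd, idxWrites, numWrites, idxArrWrites, numArrWrites, writes,
    Instr.idxWrites, Instr.numWrites, Instr.idxArrWrites, Instr.numArrWrites]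

theorem run_testWeight (s : State K) : testWeight.run s = record s
    (if s.idx 3 ≤ s.idx 6 then s.num 3 ≤ s.num 4 else s.num 4 ≤ s.num 0 → s.num 2 ≤ s.num 0) := by
  simp only [testWeight, Cmd.run, run_testNum]
  split_ifs with h₁ h₂ <;> simp [*, record_true]

theorem ite_one_eq_zero {φ : Prop} [Decidable φ] {m : ℕ} :
    (if φ then m else 1) = 0 ↔ m = 0 ∧ φ := by
  split_ifs with h <;> simp [h]

/-- The effect of reading one entry. -/
theorem run_readEntry {s₀ s : State K} (h : Ready s₀ s) {e i a b r : ℕ} {x : K}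
    (he : s.idx 12 = e) (hi : s₀.idxArr 1 e 0 = i) (ha : s₀.idxArr 1 e 1 = a)
    (hb : s₀.idxArr 1 e 2 = b) (hx : s₀.numArr 2 e 0 = x) (hr : s.idxArr 5 i 0 + a = r) :
    ((readEntry.run s).idx 5 = 0 ↔ s.idx 5 = 0 ∧ EntryTest (s₀.idx 0) (s₀.idx 1) (s₀.idx 3) i a b x
      (s.numArr 5 r b + x) (s₀.numArr 0 a b)) ∧
    ((readEntry.run s).numArr 5 = fun k l =>
      s.numArr 5 k l + if (r, b) = (k, l) then x else 0) ∧
    ((readEntry.run s).numArr 6 = fun k l =>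
      s.numArr 6 k l + ((if (i, a) = (k, l) then x else 0) - if (i, b) = (k, l) then x else 0)) ∧
    ((readEntry.run s).numArr 7 = fun k l =>
      s.numArr 7 k l + if (i, a) = (k, l) then x else 0) := by
  have k0 := h.idx 0 (by omega)
  have k1 := h.idx 1 (by omega)
  have k3 := h.idx 3 (by omega)
  have a1 := h.idxArr 1 (by omega)
  have n0 := h.numArr 0 (by omega)
  have n2 := h.numArr 2 (by omega)
  simp only [readEntry, loadEntry, testEntry, addEntry, run_seq, run_testWeight, run_testIdx,
    run_testNum, run_ins, exec]
  refine ⟨?_, ?_, ?_, ?_⟩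
  · simp only [record_flag]
    simp [record, h.zero, h.one, h.two, h.num_zero, k0, k1, k3, a1, n0, n2, he, hi, ha, hb, hx, hr,
      EntryTest, ite_one_eq_zero, and_assoc]
  · funext k l
    simp [record, h.zero, h.one, h.two, h.num_zero, k0, k1, k3, a1, n0, n2, he, hi, ha, hb, hx, hr]
    grind
  · funext k l
    simp [record, h.zero, h.one, h.two, h.num_zero, k0, k1, k3, a1, n0, n2, he, hi, ha, hb, hx, hr]
    grind
  · funext k l
    simp [record, h.zero, h.one, h.two, h.num_zero, k0, k1, k3, a1, n0, n2, he, hi, ha, hb, hx, hr]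
    grind

/-- The cell in which the amount of entry `k` of the guess `g` is accumulated, if pair `i` has
the offset `off i`.  With offsets `i * n`, each pair has `n` rows of its own. -/
def edgeCell (off : ℕ → ℕ) (g : ℕ → ℕ → ℕ) (k : ℕ) : ℕ × ℕ := (off (g k 0) + g k 1, g k 2)

/-- What `readFlows` computes: the outcome of the tests, the net outflows and the outflows. -/
theorem run_readFlows {s₀ s : State K} (h : Ready s₀ s) {off : ℕ → ℕ} {g : ℕ → ℕ → ℕ} {x : ℕ → K}
    (hg : s₀.idxArr 1 = g) (hx : ∀ k, s₀.numArr 2 k 0 = x k)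
    (hoff : ∀ i, s.idxArr 5 i 0 = off i) (h₅ : s.idx 5 = 0) (n₅ : s.numArr 5 = fun _ _ => 0)
    (n₆ : s.numArr 6 = fun _ _ => 0) (n₇ : s.numArr 7 = fun _ _ => 0) :
    ((readFlows.run s).idx 5 = 0 ↔ ∀ k < s₀.idx 2,
      EntryTest (s₀.idx 0) (s₀.idx 1) (s₀.idx 3) (g k 0) (g k 1) (g k 2) (x k)
        (tally (edgeCell off g) x (k + 1) (off (g k 0) + g k 1) (g k 2))
        (s₀.numArr 0 (g k 1) (g k 2))) ∧
    ((readFlows.run s).numArr 6 = fun i w =>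
      tally (fun k => (g k 0, g k 1)) x (s₀.idx 2) i w -
        tally (fun k => (g k 0, g k 2)) x (s₀.idx 2) i w) ∧
    (readFlows.run s).numArr 7 = tally (fun k => (g k 0, g k 1)) x (s₀.idx 2) := by
  have main := run_loop_induction (r := 12) (b := 2) (c := readEntry) (s := s)
    (fun e s => Ready s₀ s ∧ (∀ i, s.idxArr 5 i 0 = off i) ∧
      (s.idx 5 = 0 ↔ ∀ k < e,
        EntryTest (s₀.idx 0) (s₀.idx 1) (s₀.idx 3) (g k 0) (g k 1) (g k 2) (x k)
          (tally (edgeCell off g) x (k + 1) (off (g k 0) + g k 1) (g k 2))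
          (s₀.numArr 0 (g k 1) (g k 2))) ∧
      s.numArr 5 = tally (edgeCell off g) x e ∧
      (s.numArr 6 = fun i w => tally (fun k => (g k 0, g k 1)) x e i w -
        tally (fun k => (g k 0, g k 2)) x e i w) ∧
      s.numArr 7 = tally (fun k => (g k 0, g k 1)) x e)
    ⟨h.setIdx (by omega) _, by simpa [State.setIdx] using hoff, by simp [State.setIdx, h₅],
      by funext; simp [State.setIdx, n₅, tally], by funext; simp [State.setIdx, n₆, tally],
      by funext; simp [State.setIdx, n₇, tally]⟩ ?_
  · rw [h.idx 2 (by omega)] at main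
    exact ⟨main.2.2.1, main.2.2.2.2⟩
  · rintro e - s he ⟨r, hoff, h₅, n₅, n₆, n₇⟩
    obtain ⟨k₅, m₅, m₆, m₇⟩ := run_readEntry r he (congrFun₂ hg e 0) (congrFun₂ hg e 1)
      (congrFun₂ hg e 2) (hx e) (congrArg (· + g e 1) (hoff (g e 0)))
    refine ⟨((r.run keepsReady_readEntry).setIdx (by omega) _).setIdx (by omega) _, fun i => ?_,
      ?_, ?_, ?_, ?_⟩
    · change (readEntry.run s).idxArr 5 i 0 = _
      rw [run_idxArr _ _ (by simp [readEntry, loadEntry, testEntry, addEntry, testWeight, testIdx,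
        testNum, failCmd, idxArrWrites, writes, Instr.idxArrWrites]), hoff]
    · change Function.update (Function.update (readEntry.run s).idx 4 1) 12 (e + 1) 5 = 0 ↔ _
      simp only [ne_eq, Nat.reduceEqDiff, not_false_eq_true, Function.update_of_ne]
      rw [k₅, h₅, Nat.forall_lt_succ_right, n₅, tally_succ, edgeCell, if_pos rfl]
    · change (readEntry.run s).numArr 5 = _
      rw [m₅, n₅]
      funext k l
      rw [tally_succ, edgeCell]
    · change (readEntry.run s).numArr 6 = _
      rw [m₆, n₆]
      funext k l
      rw [tally_succ, tally_succ]
      ring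
    · change (readEntry.run s).numArr 7 = _
      rw [m₇, n₇]
      funext k l
      rw [tally_succ]

end MaxFlow

/-! ### The program: comparing the flows with the cuts -/

namespace MaxFlow

open NumRAM NumRAM.Cmd

variable {K : Type*} [Field K] [LinearOrder K]

/-- The test on node `w` for the pair `(u, v)`, if `y` is the mark of `w`, `r` the weight of the
edges that lead from marked nodes to `w`, `c` the capacity of `w`, `d` the net outflow and `o` the
outflow of `w`. -/
def NodeTest (kind u v w : ℕ) (y r c d o : K) : Prop :=
  if w = u then 0 < y
  else if w = v then y ≤ 0 ∧ (kind = 0 ∨ r ≤ 0)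
  else d = 0 ∧ (kind = 0 ∨ o ≤ c)

/-- The contribution of a node to the capacity of the cut; the notation is that of `NodeTest`. -/
def cutTerm (kind : ℕ) (y r c : K) : K :=
  if y ≤ 0 then if kind = 0 then r else if r ≤ 0 then 0 else c else 0

/-- Load the data of node `w` (register `11`) for pair `i` (register `10`). -/
def loadNode : Cmd :=
  ins (.idxSub 15 11 13) ;; ins (.idxSub 16 13 11) ;; ins (.idxAdd 15 15 16) ;;
  ins (.idxSub 16 11 14) ;; ins (.idxSub 17 14 11) ;; ins (.idxAdd 16 16 17) ;;
  ins (.idxAdd 17 11 7) ;; ins (.numLoad 2 2 10 17) ;; ins (.numLoad 3 102 10 11) ;;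
  ins (.numLoad 4 1 11 6) ;; ins (.numLoad 6 6 10 11) ;; ins (.numLoad 7 7 10 11)

/-- Test the node; index registers `15` and `16` hold its distances from `u` and `v`. -/
def testNode : Cmd :=
  ifIdx 15 6 (ifNum 2 0 failCmd skip)
    (ifIdx 16 6 (testNum 2 0 ;; ifIdx 3 6 skip (testNum 3 0))
      (testNum 6 0 ;; testNum 0 6 ;; ifIdx 3 6 skip (testNum 7 4)))

/-- Add the contribution of the node to the capacity of the cut, in number register `5`. -/
def addNode : Cmd :=
  ifNum 2 0 (ifIdx 3 6 (ins (.numAdd 5 5 3)) (ifNum 3 0 skip (ins (.numAdd 5 5 4)))) skip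

/-- Process node `w` (register `11`) for pair `i` (register `10`). -/
def checkNode : Cmd := loadNode ;; testNode ;; addNode

/-- Process pair `i` (register `10`). -/
def checkPair : Cmd :=
  ins (.idxLoad 13 0 10 6) ;; ins (.idxLoad 14 0 10 7) ;; ins (.numConst 5 0) ;;
  loop 11 0 checkNode ;;
  ins (.numLoad 6 6 10 13) ;; testNum 5 6 ;; ins (.numStore 3 10 6 5)

/-- Check all pairs. -/
def checkPairs : Cmd := loop 10 1 checkPair

theorem run_testNode (s : State K) : testNode.run s = record s
    (if s.idx 15 ≤ s.idx 6 then s.num 0 < s.num 2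
      else if s.idx 16 ≤ s.idx 6 then s.num 2 ≤ s.num 0 ∧ (s.idx 3 ≤ s.idx 6 ∨ s.num 3 ≤ s.num 0)
      else (s.num 6 ≤ s.num 0 ∧ s.num 0 ≤ s.num 6) ∧ (s.idx 3 ≤ s.idx 6 ∨ s.num 7 ≤ s.num 4)) := by
  simp only [testNode, Cmd.run, run_testNum, run_failCmd, record_record]
  have e₁ : ∀ φ, (record s φ).idx 3 = s.idx 3 := fun φ => record_idx s φ (by omega)
  have e₂ : ∀ φ, (record s φ).idx 6 = s.idx 6 := fun φ => record_idx s φ (by omega)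
  have e₃ : ∀ φ, (record s φ).num = s.num := fun φ => rfl
  simp only [e₁, e₂, e₃]
  split_ifs <;> simp [*, record_true, not_lt.2, ← not_le]

theorem run_addNode (s : State K) : addNode.run s = { s with
    num := Function.update s.num 5 (s.num 5 + if s.num 2 ≤ s.num 0 then
      if s.idx 3 ≤ s.idx 6 then s.num 3 else if s.num 3 ≤ s.num 0 then 0 else s.num 4
      else 0) } := by
  simp only [addNode, Cmd.run, exec]
  split_ifs <;> simp

theorem keepsReady_checkNode : KeepsReady checkNode := by
  simp [KeepsReady, checkNode, loadNode, testNode, addNode, testNum,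
    failCmd, idxWrites, numWrites, idxArrWrites, numArrWrites, writes,
    Instr.idxWrites, Instr.numWrites, Instr.idxArrWrites, Instr.numArrWrites]

theorem keepsReady_checkPair : KeepsReady checkPair := by
  simp [KeepsReady, checkPair, checkNode, loadNode, testNode, addNode, testNum,
    failCmd, idxWrites, numWrites, idxArrWrites, numArrWrites, writes,
    Instr.idxWrites, Instr.numWrites, Instr.idxArrWrites, Instr.numArrWrites]

variable {s₀ : State K} {d o R : ℕ → ℕ → K}

theorem run_checkNode {s : State K} (h : Ready s₀ s) (h6 : s.numArr 6 = d) (h7 : s.numArr 7 = o)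
    (hR : s.numArr 102 = R) {i u v w : ℕ} (hi : s.idx 10 = i) (hw : s.idx 11 = w)
    (hu : s.idx 13 = u) (hv : s.idx 14 = v) :
    ((checkNode.run s).idx 5 = 0 ↔ s.idx 5 = 0 ∧ NodeTest (s₀.idx 3) u v w
      (s₀.numArr 2 i (w + 1)) (R i w) (s₀.numArr 1 w 0) (d i w) (o i w)) ∧
    (checkNode.run s).num 5 = s.num 5 + cutTerm (s₀.idx 3)
      (s₀.numArr 2 i (w + 1)) (R i w) (s₀.numArr 1 w 0) := by
  have k3 := h.idx 3 (by omega)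
  have n1 := h.numArr 1 (by omega)
  have n2 := h.numArr 2 (by omega)
  have e₁ : ∀ a b : ℕ, (a - b = 0 ∧ b - a = 0) ↔ a = b := by omega
  simp only [checkNode, loadNode, run_seq, run_addNode, run_testNode, run_ins, exec]
  constructor
  · simp only [record_flag]
    simp [h.zero, h.one, h.num_zero, k3, n1, n2, h6, h7, hR, hi, hw, hu, hv, e₁, NodeTest,
      ← le_antisymm_iff]
  · simp [record, h.zero, h.one, h.num_zero, k3, n1, n2, hR, hi, hw, cutTerm]

/-- The effect of processing one pair. -/
theorem run_checkPair {s : State K} (h : Ready s₀ s) (h6 : s.numArr 6 = d) (h7 : s.numArr 7 = o)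
    (hR : s.numArr 102 = R) {i u v : ℕ} (hi : s.idx 10 = i)
    (hu : s₀.idxArr 0 i 0 = u) (hv : s₀.idxArr 0 i 1 = v) {A : K}
    (hA : ∑ w ∈ Finset.range (s₀.idx 0), cutTerm (s₀.idx 3) (s₀.numArr 2 i (w + 1)) (R i w)
      (s₀.numArr 1 w 0) = A) :
    ((checkPair.run s).idx 5 = 0 ↔ s.idx 5 = 0 ∧ (∀ w < s₀.idx 0, NodeTest (s₀.idx 3) u v w
      (s₀.numArr 2 i (w + 1)) (R i w) (s₀.numArr 1 w 0) (d i w) (o i w)) ∧ A ≤ d i u) ∧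
    (checkPair.run s).numArr 3 = fun k l => if k = i ∧ l = 0 then A else s.numArr 3 k l := by
  simp only [checkPair, run_seq]
  set s₁ := (ins (.numConst 5 0)).run ((ins (.idxLoad 14 0 10 7)).run
    ((ins (.idxLoad 13 0 10 6)).run s)) with hs₁
  have r₁ : Ready s₀ s₁ := by
    have : KeepsReady (ins (.idxLoad 13 0 10 6) ;; ins (.idxLoad 14 0 10 7) ;;
        ins (.numConst 5 0)) := by
      simp [KeepsReady, idxWrites, numWrites, idxArrWrites, numArrWrites, writes,
        Instr.idxWrites, Instr.numWrites, Instr.idxArrWrites, Instr.numArrWrites]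
    exact h.run this
  have i0 := h.idxArr 0 (by omega)
  have inner := run_loop_induction (r := 11) (b := 0) (c := checkNode) (s := s₁)
    (fun j t => Ready s₀ t ∧ t.idx 10 = i ∧ t.idx 13 = u ∧ t.idx 14 = v ∧
      (t.idx 5 = 0 ↔ s.idx 5 = 0 ∧ ∀ w < j, NodeTest (s₀.idx 3) u v w
        (s₀.numArr 2 i (w + 1)) (R i w) (s₀.numArr 1 w 0) (d i w) (o i w)) ∧
      (t.num 5 = ∑ w ∈ Finset.range j, cutTerm (s₀.idx 3) (s₀.numArr 2 i (w + 1)) (R i w)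
        (s₀.numArr 1 w 0)) ∧ t.numArr = s.numArr)
    ⟨r₁.setIdx (by omega) _, by simp [State.setIdx, hs₁, Cmd.run, exec, hi],
      by simp [State.setIdx, hs₁, Cmd.run, exec, hi, i0, h.zero, hu],
      by simp [State.setIdx, hs₁, Cmd.run, exec, hi, i0, h.one, hv],
      by simp [State.setIdx, hs₁, Cmd.run, exec], by simp [State.setIdx, hs₁, Cmd.run, exec],
      by simp [State.setIdx, hs₁, Cmd.run, exec]⟩ ?_
  · rw [r₁.idx 0 (by omega)] at inner
    set s₂ := (loop 11 0 checkNode).run s₁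
    obtain ⟨r₂, j10, j13, -, j5, j5', jn⟩ := inner
    simp only [run_testNum, run_ins, exec]
    constructor
    · rw [record_flag]
      simp [j5, j5', hA, jn, j10, j13, h6, and_assoc]
    · simp [record, jn, j10, r₂.zero, j5', hA]
  · rintro w - t hw ⟨r, j10, j13, j14, j5, j5', jn⟩
    obtain ⟨k₁, k₂⟩ := run_checkNode r (jn ▸ h6) (jn ▸ h7) (jn ▸ hR) j10 hw j13 j14
    have frame : ∀ x, x = 10 ∨ x = 13 ∨ x = 14 →
        (((checkNode.run t).setIdx 4 1).setIdx 11 (w + 1)).idx x = t.idx x := by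
      intro x hx
      change Function.update (Function.update (checkNode.run t).idx 4 1) 11 (w + 1) x = _
      rw [Function.update_of_ne (by omega), Function.update_of_ne (by omega)]
      refine run_idx _ _ ?_
      rcases hx with rfl | rfl | rfl <;> simp [checkNode, loadNode, testNode, addNode, testNum,
        failCmd, idxWrites, writes, Instr.idxWrites]
    refine ⟨((r.run keepsReady_checkNode).setIdx (by omega) _).setIdx (by omega) _,
      (frame 10 (by omega)).trans j10, (frame 13 (by omega)).trans j13,
      (frame 14 (by omega)).trans j14, ?_, ?_, ?_⟩
    · change Function.update (Function.update (checkNode.run t).idx 4 1) 11 (w + 1) 5 = 0 ↔ _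
      simp only [ne_eq, Nat.reduceEqDiff, not_false_eq_true, Function.update_of_ne]
      rw [k₁, j5, Nat.forall_lt_succ_right, and_assoc]
    · change (checkNode.run t).num 5 = _
      rw [k₂, j5', Finset.sum_range_succ]
    · change (checkNode.run t).numArr = _
      rw [← jn]
      funext x
      exact run_numArr _ _ (by simp [checkNode, loadNode, testNode, addNode, testNum,
        failCmd, numArrWrites, writes, Instr.numArrWrites])

/-- What `checkPairs` computes: the outcome of the tests, and in the output the capacities of the
cuts, if `R` holds the product of the matrix of the cuts and the weight matrix. -/
theorem run_checkPairs {s : State K} (h : Ready s₀ s) (h6 : s.numArr 6 = d) (h7 : s.numArr 7 = o)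
    (hR : s.numArr 102 = R) {u v : ℕ → ℕ} (hu : ∀ i, s₀.idxArr 0 i 0 = u i)
    (hv : ∀ i, s₀.idxArr 0 i 1 = v i) {A : ℕ → K}
    (hA : ∀ i, ∑ w ∈ Finset.range (s₀.idx 0), cutTerm (s₀.idx 3) (s₀.numArr 2 i (w + 1)) (R i w)
      (s₀.numArr 1 w 0) = A i) :
    Ready s₀ (checkPairs.run s) ∧
    ((checkPairs.run s).idx 5 = 0 ↔ s.idx 5 = 0 ∧ ∀ i < s₀.idx 1, (∀ w < s₀.idx 0,
      NodeTest (s₀.idx 3) (u i) (v i) w (s₀.numArr 2 i (w + 1)) (R i w) (s₀.numArr 1 w 0)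
        (d i w) (o i w)) ∧ A i ≤ d i (u i)) ∧
    ∀ i < s₀.idx 1, (checkPairs.run s).numArr 3 i 0 = A i := by
  have main := run_loop_induction (r := 10) (b := 1) (c := checkPair) (s := s)
    (fun j t => Ready s₀ t ∧ (t.numArr 6 = d ∧ t.numArr 7 = o ∧ t.numArr 102 = R) ∧
      (t.idx 5 = 0 ↔ s.idx 5 = 0 ∧ ∀ i < j, (∀ w < s₀.idx 0,
        NodeTest (s₀.idx 3) (u i) (v i) w (s₀.numArr 2 i (w + 1)) (R i w) (s₀.numArr 1 w 0)
          (d i w) (o i w)) ∧ A i ≤ d i (u i)) ∧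
      ∀ i < j, t.numArr 3 i 0 = A i)
    ⟨h.setIdx (by omega) _, ⟨h6, h7, hR⟩, by simp [State.setIdx], by simp⟩ ?_
  · rw [h.idx 1 (by omega)] at main
    exact ⟨main.1, main.2.2⟩
  · rintro i - t hi ⟨r, ⟨h6, h7, hR⟩, j5, j3⟩
    obtain ⟨k₁, k₂⟩ := run_checkPair r h6 h7 hR hi (hu i) (hv i) (hA i)
    have frame : ∀ x, x ≠ 3 → (checkPair.run t).numArr x = t.numArr x := fun x hx =>
      run_numArr _ _ (by simp [checkPair, checkNode, loadNode, testNode, addNode, testNum,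
        failCmd, numArrWrites, writes, Instr.numArrWrites, hx])
    refine ⟨((r.run keepsReady_checkPair).setIdx (by omega) _).setIdx (by omega) _,
      ⟨(frame 6 (by omega)).trans h6, (frame 7 (by omega)).trans h7,
        (frame 102 (by omega)).trans hR⟩, ?_, ?_⟩
    · change Function.update (Function.update (checkPair.run t).idx 4 1) 10 (i + 1) 5 = 0 ↔ _
      simp only [ne_eq, Nat.reduceEqDiff, not_false_eq_true, Function.update_of_ne]
      rw [k₁, j5, Nat.forall_lt_succ_right, and_assoc]
    · intro k hk
      change (checkPair.run t).numArr 3 k 0 = _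
      rw [k₂]
      by_cases hki : k = i
      · simp [hki]
      · simpa [hki] using j3 k (by omega)

end MaxFlow

/-! ### The program: assembly and specification -/

namespace MaxFlow

open NumRAM NumRAM.Cmd

variable {K : Type*} [Field K] [LinearOrder K] {n q : ℕ}

/-- Hand the dimensions over to the subroutine for matrix multiplication. -/
def setDims : Cmd :=
  ins (.idxAdd 100 1 6) ;; ins (.idxAdd 101 0 6) ;; ins (.idxAdd 102 0 6)

/-- Everything before the matrix multiplication. -/
def front : Cmd := prepare ;; readFlows ;; setDims

/-- Registers and index arrays of the subroutine. -/
def subName (x : ℕ) : ℕ := x + 100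

/-- Number arrays of the subroutine: its second factor is the weight matrix in array `0`. -/
def subArr (x : ℕ) : ℕ := if x = 1 then 0 else x + 100

theorem subName_injective : Function.Injective subName := fun x y h => by
  simp only [subName] at h; omega

theorem subArr_injective : Function.Injective subArr := fun x y h => by
  simp only [subArr] at h; split_ifs at h <;> omega

/-- The program that checks guessed flows and cuts, with `P` for the matrix multiplication. -/
def verifier (P : Program) : Program :=
  front.code 0 ++ (P.map (Instr.relocate subName subArr front.len (front.len + P.length)) ++
    (checkPairs.code (front.len + P.length) ++
      [.idxJump 5 6 (front.len + P.length + checkPairs.len + 2), .halt false, .halt true]))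

/-- The guessed cuts as a `0`-`1` matrix. -/
def cutMatrix (n q : ℕ) (g : Guess K) : Matrix (Fin q) (Fin n) K :=
  fun i w => if 0 < g.num (i, w + 1) then 1 else 0

/-- The table of offsets that `prepare` computes. -/
def offset (n q i : ℕ) : ℕ := if i < q then i * n else 0

/-- The outflow of `w` for pair `i` in the guessed flows. -/
def guessOut (B : ℕ) (g : Guess K) (i w : ℕ) : K :=
  tally (fun k => (g.idx (k, 0), g.idx (k, 1))) (fun k => g.num (k, 0)) B i w

/-- The net outflow of `w` for pair `i` in the guessed flows. -/
def guessNet (B : ℕ) (g : Guess K) (i w : ℕ) : K :=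
  guessOut B g i w - tally (fun k => (g.idx (k, 0), g.idx (k, 2))) (fun k => g.num (k, 0)) B i w

/-- The capacity of the guessed cut for pair `i`, as computed by the program. -/
def guessCap (x : Query K n q) (g : Guess K) (i : Fin q) : K :=
  ∑ w : Fin n, cutTerm x.graph.kind (g.num (i, w + 1))
    ((cutMatrix n q g * Matrix.of x.graph.weight) i w) (x.graph.nodeWeight w 0)

/-- All tests of the program succeed. -/
def Accepts (x : Query K n q) (B : ℕ) (g : Guess K) : Prop :=
  (∀ k < B, EntryTest n q x.graph.kind (g.idx (k, 0)) (g.idx (k, 1)) (g.idx (k, 2)) (g.num (k, 0))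
    (tally (edgeCell (offset n q) fun k j => g.idx (k, j)) (fun k => g.num (k, 0)) (k + 1)
      (offset n q (g.idx (k, 0)) + g.idx (k, 1)) (g.idx (k, 2)))
    (table x.graph.weight (g.idx (k, 1)) (g.idx (k, 2)))) ∧
  ∀ i : Fin q, (∀ w : Fin n, NodeTest x.graph.kind (x.pair i).1 (x.pair i).2 w (g.num (i, w + 1))
      ((cutMatrix n q g * Matrix.of x.graph.weight) i w) (x.graph.nodeWeight w 0)
      (guessNet B g i w) (guessOut B g i w)) ∧
    guessCap x g i ≤ guessNet B g i (x.pair i).1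

theorem wellFormed_front : front.WellFormed := by
  simp [front, prepare, markPair, markNode, readFlows, readEntry, loadEntry, testEntry, addEntry,
    testWeight, testIdx, testNum, failCmd, setDims, WellFormed, idxWrites, writes,
    Instr.idxWrites, Instr.straight]

theorem wellFormed_checkPairs : checkPairs.WellFormed := by
  simp [checkPairs, checkPair, checkNode, loadNode, testNode, addNode, testNum, failCmd,
    WellFormed, idxWrites, writes, Instr.idxWrites, Instr.straight]

theorem cost_front_le {f : ℕ → ℕ} (h₀ : 1 ≤ f 0) (h₁ : 1 ≤ f 1) :
    front.cost f ≤ 70 * (f 1 * f 0 + f 2) := by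
  have h₂ : f 1 ≤ f 1 * f 0 := Nat.le_mul_of_pos_right _ h₀
  simp only [front, prepare, markPair, markNode, readFlows, readEntry, loadEntry, testEntry,
    addEntry, testWeight, testIdx, testNum, failCmd, setDims, cost]
  ring_nf
  have := Nat.mul_comm (f 0) (f 1)
  omega

theorem cost_checkPairs_le {f : ℕ → ℕ} (h₀ : 1 ≤ f 0) (h₁ : 1 ≤ f 1) :
    checkPairs.cost f ≤ 70 * (f 1 * f 0) := by
  have h₂ : f 1 ≤ f 1 * f 0 := Nat.le_mul_of_pos_right _ h₀
  simp only [checkPairs, checkPair, checkNode, loadNode, testNode, addNode, testNum, failCmd, cost]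
  ring_nf
  have := Nat.mul_comm (f 0) (f 1)
  omega

/-- What the program has computed before the matrix multiplication. -/
theorem run_front (x : Query K n q) (B : ℕ) (g : Guess K) :
    let s₀ := queryInit x B g
    let s := front.run s₀
    Ready s₀ s ∧
    (s.idx 5 = 0 ↔ ∀ k < B, EntryTest n q x.graph.kind (g.idx (k, 0)) (g.idx (k, 1)) (g.idx (k, 2))
      (g.num (k, 0))
      (tally (edgeCell (offset n q) fun k j => g.idx (k, j)) (fun k => g.num (k, 0)) (k + 1)
        (offset n q (g.idx (k, 0)) + g.idx (k, 1)) (g.idx (k, 2)))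
      (table x.graph.weight (g.idx (k, 1)) (g.idx (k, 2)))) ∧
    s.numArr 6 = guessNet B g ∧ s.numArr 7 = guessOut B g ∧
    Embeds subName subArr (mulInit (cutMatrix n q g) (Matrix.of x.graph.weight)) s := by
  intro s₀ s
  obtain ⟨r₁, off₁, Y₁⟩ := run_prepare (s₀ := s₀) rfl rfl rfl rfl rfl
  set s₁ := prepare.run s₀ with hs₁
  have frame : ∀ y, 5 ≤ y → y < 8 → s₁.numArr y = fun _ _ => 0 := fun y h₁ h₂ => by
    rw [hs₁, run_numArr _ _ (by
      simp [prepare, markPair, markNode, numArrWrites, writes, Instr.numArrWrites]; omega)]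
    simp only [s₀, queryInit]
    rw [if_neg (by omega), if_neg (by omega), if_neg (by omega)]
  have flag : s₁.idx 5 = 0 := by
    rw [hs₁, run_idx _ _ (by simp [prepare, markPair, markNode, idxWrites, writes,
      Instr.idxWrites])]
    rfl
  have hread := run_readFlows r₁ (off := offset n q) (g := fun k j => g.idx (k, j))
    (x := fun k => g.num (k, 0)) rfl (fun k => rfl)
    (fun i => by rw [off₁]; simp [offset, s₀, queryInit]) flag (frame 5 (by omega) (by omega))
    (frame 6 (by omega) (by omega)) (frame 7 (by omega) (by omega))
  have r₂ : Ready s₀ (readFlows.run s₁) := by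
    refine r₁.run ?_
    simp [KeepsReady, readFlows, readEntry, loadEntry, testEntry, addEntry, testWeight, testIdx,
      testNum, failCmd, idxWrites, numWrites, idxArrWrites, numArrWrites, writes,
      Instr.idxWrites, Instr.numWrites, Instr.idxArrWrites, Instr.numArrWrites]
  have r₃ : Ready s₀ s := by
    have : s = setDims.run (readFlows.run s₁) := rfl
    rw [this]
    refine r₂.run ?_
    simp [KeepsReady, setDims, idxWrites, numWrites, idxArrWrites, numArrWrites, writes,
      Instr.idxWrites, Instr.numWrites, Instr.idxArrWrites, Instr.numArrWrites]
  have hs : s = setDims.run (readFlows.run s₁) := rfl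
  obtain ⟨f₁, f₂, f₃⟩ := hread
  refine ⟨r₃, ?_, ?_, ?_, ?_⟩
  · rw [hs, run_idx _ _ (by simp [setDims, idxWrites, writes, Instr.idxWrites])]
    exact f₁
  · rw [hs, run_numArr _ _ (by simp [setDims, numArrWrites, writes, Instr.numArrWrites])]
    exact f₂
  · rw [hs, run_numArr _ _ (by simp [setDims, numArrWrites, writes, Instr.numArrWrites])]
    exact f₃
  · constructor
    · intro y
      by_cases hy : y < 3
      · have h0 : (readFlows.run s₁).idx 0 = n := r₂.idx 0 (by omega)
        have h1 : (readFlows.run s₁).idx 1 = q := r₂.idx 1 (by omega)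
        have h6 := r₂.zero
        rw [hs]
        interval_cases y <;> simp [setDims, Cmd.run, exec, subName, mulInit, h0, h1, h6]
      · have : s.idx (subName y) = s₀.idx (subName y) := by
          refine run_idx _ _ ?_
          simp [front, prepare, markPair, markNode, readFlows, readEntry, loadEntry, testEntry,
            addEntry, testWeight, testIdx, testNum, failCmd, setDims, idxWrites, writes,
            Instr.idxWrites, subName]
          omega
        rw [this]
        simp only [s₀, queryInit, mulInit, subName]
        repeat rw [if_neg (by omega)]
    · intro y
      refine (run_num front s₀ ?_).trans rfl
      simp [front, prepare, markPair, markNode, readFlows, readEntry, loadEntry, testEntry,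
        addEntry, testWeight, testIdx, testNum, failCmd, setDims, numWrites, writes,
        Instr.numWrites, subName]
    · intro y
      refine (run_idxArr front s₀ ?_).trans ?_
      · simp [front, prepare, markPair, markNode, readFlows, readEntry, loadEntry, testEntry,
          addEntry, testWeight, testIdx, testNum, failCmd, setDims, idxArrWrites, writes,
          Instr.idxArrWrites, subName]
      · simp only [s₀, queryInit, mulInit, subName]
        repeat rw [if_neg (by omega)]
    · intro y
      by_cases hy : y = 1
      · subst hy
        exact (r₃.numArr 0 (by omega)).trans rfl
      by_cases hy' : y = 0
      · subst hy'
        rw [hs, run_numArr _ _ (by simp [setDims, numArrWrites, writes, Instr.numArrWrites,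
          subArr]), run_numArr _ _ (by simp [readFlows, readEntry, loadEntry, testEntry,
          addEntry, testWeight, testIdx, testNum, failCmd, numArrWrites, writes,
          Instr.numArrWrites, subArr])]
        refine Y₁.trans ?_
        funext a b
        simp only [mulInit, if_true, table, cutMatrix, s₀, queryInit]
        by_cases hab : a < q ∧ b < n <;> simp [hab]
      · have hy'' : subArr y = y + 100 := if_neg hy
        refine (run_numArr front s₀ ?_).trans ?_
        · simp [front, prepare, markPair, markNode, readFlows, readEntry, loadEntry, testEntry,
            addEntry, testWeight, testIdx, testNum, failCmd, setDims, numArrWrites, writes,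
            Instr.numArrWrites, hy'']
          omega
        · simp only [s₀, queryInit, mulInit, hy'', hy, hy', if_false]
          repeat rw [if_neg (by omega)]

theorem forall_lt_iff_fin {m : ℕ} {p : ℕ → Prop} {p' : Fin m → Prop} (h : ∀ i : Fin m, p i ↔ p' i) :
    (∀ i < m, p i) ↔ ∀ i, p' i :=
  ⟨fun H i => (h i).1 (H i i.2), fun H i hi => (h ⟨i, hi⟩).2 (H ⟨i, hi⟩)⟩

/-- The program stops in time; it delivers the capacities of the guessed cuts if all tests
succeed and does not know the answer otherwise. -/
theorem verifier_spec {P : Program} {T : ℝ} (hP : MultipliesWithin K P q n n T) (x : Query K n q)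
    (B : ℕ) (g : Guess K) :
    ∃ (k : ℕ) (ok : Bool) (s' : State K), (k : ℝ) ≤ 100 * (T + B) ∧
      HaltsWithin (verifier P) (queryInit x B g) k ok s' ∧ (ok = true ↔ Accepts x B g) ∧
      ∀ i : Fin q, s'.numArr 3 i 0 = guessCap x g i := by
  obtain ⟨hT, hP⟩ := hP
  obtain ⟨kP, sP, hkP, hhalt, hmul⟩ := hP (cutMatrix n q g) (Matrix.of x.graph.weight)
  have hq : 1 ≤ q := x.nonempty
  have hn : 1 ≤ n := (x.pair ⟨0, hq⟩).1.pos
  obtain ⟨r₁, flag₁, net₁, out₁, emb₁⟩ := run_front x B g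
  set s₀ := queryInit x B g with hs₀
  set s₁ := front.run s₀ with hs₁
  set e := front.len + P.length with he
  have c₁ : CodeAt (verifier P) 0 (front.code 0 ++ _) := ⟨[], [], by simp [verifier]; rfl, rfl⟩
  have c₂ := c₁.right (c := front.len) (by simp)
  have c₃ := c₂.right (c := e) (by simp [he])
  have c₄ := c₃.right (c := e + checkPairs.len) (by simp)
  obtain ⟨t₁, ht₁, e₁⟩ := exists_iterate_step wellFormed_front c₁.left s₀ rfl
  obtain ⟨t₂, ht₂, s₂, e₂, pc₂, emb₂, agree⟩ := exists_iterate_step_relocate subName_injective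
    subArr_injective c₂.left hhalt (s := s₁.atPc (0 + front.len)) (by simp [State.atPc, mulInit])
    ⟨emb₁.idx, emb₁.num, emb₁.idxArr, emb₁.numArr⟩
  obtain ⟨t₃, ht₃, e₃⟩ := exists_iterate_step wellFormed_checkPairs c₃.left s₂ pc₂
  -- the multiplication may have destroyed the weight matrix, which is not needed any more
  set s₀' : State K := { s₀ with numArr := fun a => if a = 0 then s₂.numArr 0 else s₀.numArr a }
    with hs₀'
  have low : ∀ y < 100, ∀ z, y ≠ subName z := fun y hy z => by simp only [subName]; omega
  have low' : ∀ y < 100, y ≠ 0 → ∀ z, y ≠ subArr z := fun y hy hy' z => by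
    simp only [subArr]; split_ifs <;> omega
  have r₂ : Ready s₀' s₂ := by
    constructor
    · exact fun y hy => (agree.idx y (low y (by omega))).trans (r₁.idx y hy)
    · exact (agree.idx 6 (low 6 (by omega))).trans r₁.zero
    · exact (agree.idx 7 (low 7 (by omega))).trans r₁.one
    · exact (agree.idx 8 (low 8 (by omega))).trans r₁.two
    · exact (agree.num 0 (low 0 (by omega))).trans r₁.num_zero
    · exact (agree.num 1 (low 1 (by omega))).trans r₁.num_one
    · exact fun y hy => (agree.idxArr y (low y (by omega))).trans (r₁.idxArr y hy)
    · intro y hy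
      by_cases hy' : y = 0
      · simp [hs₀', hy']
      · simpa [hs₀', hy'] using
          (agree.numArr y (low' y (by omega) hy')).trans (r₁.numArr y hy)
  have net₂ := (agree.numArr 6 (low' 6 (by omega) (by omega))).trans net₁
  have out₂ := (agree.numArr 7 (low' 7 (by omega) (by omega))).trans out₁
  have flag₂ : s₂.idx 5 = s₁.idx 5 := agree.idx 5 (low 5 (by omega))
  have prod : ∀ (i : Fin q) (w : Fin n), s₂.numArr 102 i w =
      (cutMatrix n q g * Matrix.of x.graph.weight) i w := fun i w => by
    rw [← hmul i w, ← emb₂.numArr 2]; rfl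
  obtain ⟨r₃, flag₃, cap₃⟩ := run_checkPairs r₂ net₂ out₂ rfl (fun _ => rfl) (fun _ => rfl)
    (fun _ => rfl)
  set s₃ := checkPairs.run s₂ with hs₃
  have hnode : ∀ w : Fin n, s₀.numArr 1 w 0 = x.graph.nodeWeight w 0 := fun w => by
    simp [hs₀, queryInit, table]
  have hcap : ∀ i : Fin q, ∑ w ∈ Finset.range (s₀'.idx 0), cutTerm (s₀'.idx 3)
      (s₀'.numArr 2 i (w + 1)) (s₂.numArr 102 i w) (s₀'.numArr 1 w 0) = guessCap x g i := by
    intro i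
    change ∑ w ∈ Finset.range n, cutTerm x.graph.kind (g.num (i, w + 1)) (s₂.numArr 102 i w)
      (s₀.numArr 1 w 0) = _
    rw [Finset.sum_range]
    simp only [prod, hnode, guessCap]
  have hu : ∀ i : Fin q, s₀'.idxArr 0 i 0 = (x.pair i).1 := fun i => by
    simp [hs₀', hs₀, queryInit, table]
  have hv : ∀ i : Fin q, s₀'.idxArr 0 i 1 = (x.pair i).2 := fun i => by
    simp [hs₀', hs₀, queryInit, table]
  have accept : s₃.idx 5 = 0 ↔ Accepts x B g := by
    rw [flag₃, flag₂, flag₁, Accepts]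
    refine and_congr_right fun _ => ?_
    refine forall_lt_iff_fin (m := q) fun i =>
      and_congr (forall_lt_iff_fin (m := n) fun w => ?_) ?_
    · rw [hu, hv, prod]
      change NodeTest _ _ _ _ _ _ (s₀.numArr 1 w 0) _ _ ↔ _
      rw [hnode]
      rfl
    · rw [hu, hcap]
  have final : (step (verifier P))^[1 + (t₃ + (t₂ + t₁))] s₀ =
      exec (s₃.atPc (e + checkPairs.len)) (.idxJump 5 6 (e + checkPairs.len + 2)) := by
    rw [Function.iterate_add_apply, Function.iterate_add_apply _ t₃,
      Function.iterate_add_apply _ t₂, e₁, e₂, e₃, Function.iterate_one]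
    exact c₄.step_eq rfl
  have cost₁ : front.cost s₀.idx ≤ 70 * (q * n + B) :=
    cost_front_le (f := s₀.idx) hn hq
  have cost₃ : checkPairs.cost s₂.idx ≤ 70 * (q * n) := by
    rw [wellFormed_checkPairs.cost_congr (g := s₀.idx) r₂.idx]
    exact cost_checkPairs_le (f := s₀.idx) hn hq
  refine ⟨1 + (t₃ + (t₂ + t₁)), decide (s₃.idx 5 = 0), _, ?_, ⟨final, ?_⟩, ?_, ?_⟩
  · have h₁ : 1 ≤ q * n := Nat.mul_pos hq hn
    have h₂ : 1 + (t₃ + (t₂ + t₁)) ≤ 71 * (q * n + n * n + q * n) + 70 * B + kP := by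
      have := Nat.zero_le (n * n)
      omega
    have h₃ : ((1 + (t₃ + (t₂ + t₁)) : ℕ) : ℝ) ≤
        71 * ((q * n + n * n + q * n : ℕ) : ℝ) + 70 * B + kP := by exact_mod_cast h₂
    have h₄ : (0 : ℝ) ≤ B := Nat.cast_nonneg B
    have h₅ : (0 : ℝ) ≤ ((q * n + n * n + q * n : ℕ) : ℝ) := Nat.cast_nonneg _
    linarith
  · by_cases h : s₃.idx 5 = 0
    · have : (verifier P)[e + checkPairs.len + 2]? = some (.halt true) := c₄.get? (by simp)
      simpa [exec, State.atPc, h] using this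
    · have : (verifier P)[e + checkPairs.len + 1]? = some (.halt false) := c₄.get? (by simp)
      simpa [exec, State.atPc, h, r₃.zero] using this
  · simpa using accept
  · intro i
    exact (cap₃ i i.2).trans (hcap i)

end MaxFlow

/-! ### Accepted guesses are flows and cuts of the same value -/

namespace MaxFlow

open NumRAM

variable {K : Type*} [Field K] [LinearOrder K] {n q : ℕ}

/-- The flow for pair `i` on the edge `(a, b)` in the first `m` entries of the guess. -/
def guessFlow (m : ℕ) (g : Guess K) (i a b : ℕ) : K :=
  ∑ k ∈ Finset.range m,
    if g.idx (k, 0) = i ∧ g.idx (k, 1) = a ∧ g.idx (k, 2) = b then g.num (k, 0) else 0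

omit [LinearOrder K] in
theorem sum_guessFlow_tail {B : ℕ} {g : Guess K} (hb : ∀ k < B, g.idx (k, 2) < n) (i w : ℕ) :
    ∑ b : Fin n, guessFlow B g i w b = guessOut B g i w := by
  simp only [guessFlow, guessOut, tally]
  rw [Finset.sum_comm]
  refine Finset.sum_congr rfl fun k hk => ?_
  rw [Finset.sum_eq_single_of_mem ⟨g.idx (k, 2), hb k (Finset.mem_range.1 hk)⟩ (Finset.mem_univ _)]
  · simp
  · intro b _ hbk
    rw [if_neg]
    rintro ⟨-, -, h⟩
    exact hbk (Fin.ext h.symm)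

omit [LinearOrder K] in
theorem sum_guessFlow_head {B : ℕ} {g : Guess K} (ha : ∀ k < B, g.idx (k, 1) < n) (i w : ℕ) :
    ∑ a : Fin n, guessFlow B g i a w =
      tally (fun k => (g.idx (k, 0), g.idx (k, 2))) (fun k => g.num (k, 0)) B i w := by
  simp only [guessFlow, tally]
  rw [Finset.sum_comm]
  refine Finset.sum_congr rfl fun k hk => ?_
  rw [Finset.sum_eq_single_of_mem ⟨g.idx (k, 1), ha k (Finset.mem_range.1 hk)⟩ (Finset.mem_univ _)]
  · simp
  · intro b _ hbk
    rw [if_neg]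
    rintro ⟨-, h, -⟩
    exact hbk (Fin.ext h.symm)

omit [LinearOrder K] in
theorem guessNet_eq {B : ℕ} {g : Guess K} (ha : ∀ k < B, g.idx (k, 1) < n)
    (hb : ∀ k < B, g.idx (k, 2) < n) (i w : ℕ) :
    guessNet B g i w = ∑ b : Fin n, guessFlow B g i w b - ∑ a : Fin n, guessFlow B g i a w := by
  rw [guessNet, sum_guessFlow_tail hb, sum_guessFlow_head ha]

omit [LinearOrder K] in
/-- The cells in which the program accumulates the flows of different pairs do not overlap. -/
theorem tally_edgeCell {m : ℕ} {g : Guess K} (hi : ∀ k < m, g.idx (k, 0) < q)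
    (ha : ∀ k < m, g.idx (k, 1) < n) {i a b : ℕ} (hiq : i < q) (han : a < n) :
    tally (edgeCell (offset n q) fun k j => g.idx (k, j)) (fun k => g.num (k, 0)) m
      (offset n q i + a) b = guessFlow m g i a b := by
  refine Finset.sum_congr rfl fun k hk => ?_
  have hk := Finset.mem_range.1 hk
  refine if_congr ?_ rfl rfl
  simp only [edgeCell, offset, if_pos (hi k hk), if_pos hiq, Prod.mk.injEq, ← and_assoc]
  refine and_congr_left fun _ => ⟨fun h => ?_, fun h => by rw [h.1, h.2]⟩
  have hn : 0 < n := by omega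
  have h₁ := congrArg (· / n) h
  have h₂ := congrArg (· % n) h
  simp only [Nat.mul_add_mod', Nat.mod_eq_of_lt (ha k hk), Nat.mod_eq_of_lt han] at h₂
  rw [h₂] at h
  exact ⟨Nat.eq_of_mul_eq_mul_right hn (by omega), h₂⟩

variable [IsStrictOrderedRing K]

theorem guessFlow_nonneg {m : ℕ} {g : Guess K} (hx : ∀ k < m, 0 ≤ g.num (k, 0)) (i a b : ℕ) :
    0 ≤ guessFlow m g i a b :=
  Finset.sum_nonneg fun k hk => by
    split_ifs
    exacts [hx k (Finset.mem_range.1 hk), le_rfl]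

theorem guessFlow_mono {m m' : ℕ} (h : m ≤ m') {g : Guess K} (hx : ∀ k < m', 0 ≤ g.num (k, 0))
    (i a b : ℕ) : guessFlow m g i a b ≤ guessFlow m' g i a b :=
  Finset.sum_le_sum_of_subset_of_nonneg (Finset.range_subset_range.2 h) fun k hk _ => by
    split_ifs
    exacts [hx k (Finset.mem_range.1 hk), le_rfl]

theorem le_guessFlow {m k : ℕ} (hk : k < m) {g : Guess K} (hx : ∀ k < m, 0 ≤ g.num (k, 0)) :
    g.num (k, 0) ≤ guessFlow m g (g.idx (k, 0)) (g.idx (k, 1)) (g.idx (k, 2)) := by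
  have := Finset.single_le_sum (f := fun k' => if g.idx (k', 0) = g.idx (k, 0) ∧
    g.idx (k', 1) = g.idx (k, 1) ∧ g.idx (k', 2) = g.idx (k, 2) then g.num (k', 0) else 0)
    (fun k' hk' => by
      split_ifs
      exacts [hx k' (Finset.mem_range.1 hk'), le_rfl]) (Finset.mem_range.2 hk)
  simpa [guessFlow] using this

/-- The guessed cut for pair `i`. -/
def guessCut (n : ℕ) (g : Guess K) (i : ℕ) : Finset (Fin n) :=
  Finset.univ.filter fun w => 0 < g.num (i, (w : ℕ) + 1)

omit [IsStrictOrderedRing K] in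
theorem cutMatrix_mul_apply (g : Guess K) (W : Fin n → Fin n → K) (i : Fin q) (w : Fin n) :
    (cutMatrix n q g * Matrix.of W) i w = ∑ a ∈ guessCut n g i, W a w := by
  simp [Matrix.mul_apply, cutMatrix, guessCut, Finset.sum_filter]

theorem sum_adj_nonpos_iff (adj : Fin n → Fin n → Bool) (S : Finset (Fin n)) (w : Fin n) :
    (∑ a ∈ S, if adj a w then (1 : K) else 0) ≤ 0 ↔ ∀ a ∈ S, ¬ adj a w := by
  have h₀ : ∀ a ∈ S, (0 : K) ≤ if adj a w then 1 else 0 := fun a _ => by split_ifs <;> simp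
  constructor
  · intro h a ha haw
    have := (Finset.sum_eq_zero_iff_of_nonneg h₀).1 (le_antisymm h (Finset.sum_nonneg h₀)) a ha
    simp [haw] at this
  · intro h
    exact (Finset.sum_eq_zero fun a ha => by simp [h a ha]).le

theorem guessCap_eq_cutCap (x : Query K n q) (g : Guess K) (i : Fin q) :
    guessCap x g i = x.graph.cutCap (guessCut n g i) := by
  have hS : ∀ w : Fin n, g.num (i, (w : ℕ) + 1) ≤ 0 ↔ w ∈ (guessCut n g i)ᶜ := fun w => by
    simp [guessCut]
  simp only [guessCap, cutMatrix_mul_apply, cutTerm, hS]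
  cases hG : x.graph with
  | edgeCap c hc =>
    simp only [CapGraph.kind, CapGraph.weight, CapGraph.cutCap, if_true]
    rw [← Finset.sum_filter, Finset.filter_univ_mem]
  | nodeCap adj c hc =>
    simp only [CapGraph.kind, CapGraph.weight, CapGraph.cutCap, CapGraph.nodeWeight,
      one_ne_zero, if_false, sum_adj_nonpos_iff]
    rw [Finset.sum_filter, ← Finset.sum_filter (fun w => w ∈ (guessCut n g i)ᶜ),
      Finset.filter_univ_mem]
    refine Finset.sum_congr rfl fun w _ => ?_
    by_cases h : ∃ a ∈ guessCut n g i, adj a w = true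
    · rw [if_pos h, if_neg (by simpa using h)]
    · rw [if_neg h, if_pos (by simpa using h)]

/-- Soundness: an accepted guess consists of flows and of cuts of the same values. -/
theorem Accepts.isMaxFlowValue {x : Query K n q} {B : ℕ} {g : Guess K} (h : Accepts x B g)
    (i : Fin q) : IsMaxFlowValue x.graph (x.pair i).1 (x.pair i).2 (guessCap x g i) := by
  obtain ⟨hE, hN⟩ := h
  obtain ⟨hN, hle⟩ := hN i
  have hi : ∀ k < B, g.idx (k, 0) < q := fun k hk => (hE k hk).1
  have ha : ∀ k < B, g.idx (k, 1) < n := fun k hk => (hE k hk).2.1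
  have hb : ∀ k < B, g.idx (k, 2) < n := fun k hk => (hE k hk).2.2.1
  have hx : ∀ k < B, 0 ≤ g.num (k, 0) := fun k hk => (hE k hk).2.2.2.1
  have hW : ∀ k < B, if x.graph.kind = 0 then guessFlow (k + 1) g (g.idx (k, 0)) (g.idx (k, 1))
      (g.idx (k, 2)) ≤ table x.graph.weight (g.idx (k, 1)) (g.idx (k, 2))
      else (table x.graph.weight (g.idx (k, 1)) (g.idx (k, 2)) ≤ 0 → g.num (k, 0) ≤ 0) := by
    intro k hk
    have := (hE k hk).2.2.2.2
    rwa [tally_edgeCell (fun k' hk' => hi k' (by omega)) (fun k' hk' => ha k' (by omega))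
      (hi k hk) (ha k hk)] at this
  have htable : ∀ a b : Fin n, table x.graph.weight a b = x.graph.weight a b := fun a b => by
    simp [table]
  set u := (x.pair i).1 with hu
  set v := (x.pair i).2 with hv
  have huv : u ≠ v := x.distinct i
  set f : Fin n → Fin n → K := fun a b => guessFlow B g i a b with hf
  have hother : ∀ w, w ≠ u → w ≠ v → guessNet B g i w = 0 ∧
      (x.graph.kind = 0 ∨ guessOut B g i w ≤ x.graph.nodeWeight w 0) := by
    intro w hwu hwv
    have := hN w
    rwa [NodeTest, if_neg (fun h => hwu (Fin.ext h)), if_neg (fun h => hwv (Fin.ext h))] at this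
  have hflow : IsFlow x.graph u v f := by
    refine ⟨fun a b => guessFlow_nonneg hx i a b, ?_, fun w hwu hwv => ?_⟩
    · cases hG : x.graph with
      | edgeCap c hc =>
        simp only [hG, CapGraph.kind, CapGraph.weight, if_true] at hW htable
        intro a b
        suffices ∀ m ≤ B, guessFlow m g i a b ≤ c a b from this B le_rfl
        intro m hm
        induction m with
        | zero => simpa [guessFlow] using hc a b
        | succ m ih =>
          by_cases hm' : g.idx (m, 0) = i ∧ g.idx (m, 1) = a ∧ g.idx (m, 2) = b
          · have := hW m (by omega)
            rwa [hm'.1, hm'.2.1, hm'.2.2, htable] at this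
          · rw [guessFlow, Finset.sum_range_succ, if_neg hm', add_zero]
            exact ih (by omega)
      | nodeCap adj c hc =>
        simp only [hG, CapGraph.kind, CapGraph.weight, CapGraph.nodeWeight, one_ne_zero,
          if_false, false_or] at hW htable hother
        refine ⟨fun a b hab => ?_, fun w hwu hwv => ?_⟩
        · obtain ⟨k, hk, hne⟩ := Finset.exists_ne_zero_of_sum_ne_zero hab
          have hk := Finset.mem_range.1 hk
          split_ifs at hne with hk'
          · by_contra hadj
            refine hne (le_antisymm (hW k hk ?_) (hx k hk))
            rw [hk'.2.1, hk'.2.2, htable]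
            simp [hadj]
          · exact absurd rfl hne
        · rw [sum_guessFlow_tail hb]
          exact (hother w hwu hwv).2
    · have := (hother w hwu hwv).1
      rwa [guessNet_eq ha hb, sub_eq_zero] at this
  have hcut : x.graph.IsCut u v (guessCut n g i) := by
    have h₁ := hN u
    have h₂ := hN v
    rw [NodeTest, if_pos rfl] at h₁
    rw [NodeTest, if_neg (fun h => huv (Fin.ext h.symm)), if_pos rfl, cutMatrix_mul_apply] at h₂
    refine ⟨by simpa [guessCut] using h₁, by simpa [guessCut] using h₂.1, ?_⟩
    cases hG : x.graph with
    | edgeCap c hc => trivial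
    | nodeCap adj c hc =>
      simpa only [hG, CapGraph.kind, CapGraph.weight, one_ne_zero, false_or,
        sum_adj_nonpos_iff] using h₂.2
  rw [guessCap_eq_cutCap] at hle ⊢
  rw [guessNet_eq ha hb] at hle
  exact ⟨⟨f, hflow, le_antisymm (hflow.val_le_cutCap hcut) hle⟩,
    fun p ⟨f', hf', hp⟩ => hp ▸ hf'.val_le_cutCap hcut⟩

/-! ### Maximum flows and minimum cuts form an accepted guess -/

/-- Flows of total volume at most `B` and arbitrary cuts can be written down as a guess. -/
theorem exists_guess {B : ℕ} (hq : 0 < q) (hn : 0 < n) (f : Fin q → Fin n → Fin n → K)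
    (h₀ : ∀ i a b, 0 ≤ f i a b) (hB : ∑ i, vol (f i) ≤ B) (S : Fin q → Finset (Fin n)) :
    ∃ g : Guess K, (∀ k, g.idx (k, 0) < q ∧ g.idx (k, 1) < n ∧ g.idx (k, 2) < n ∧
        0 ≤ g.num (k, 0)) ∧
      (∀ (i : Fin q) (a b : Fin n), guessFlow B g i a b = f i a b) ∧
      ∀ i : Fin q, guessCut n g i = S i := by
  classical
  let E : Finset (Fin q × Fin n × Fin n) := Finset.univ.filter fun e => f e.1 e.2.1 e.2.2 ≠ 0
  have hE : E.card ≤ B := by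
    refine le_of_eq_of_le ?_ hB
    simp only [E, vol, Finset.card_filter, Fintype.sum_prod_type]
  let φ : Fin E.card ≃ E := E.equivFin.symm
  -- the entries: the edges in the supports of the flows, followed by zeros
  let entry : ℕ → ℕ → ℕ := fun k j => if h : k < E.card then
    if j = 0 then (φ ⟨k, h⟩).1.1 else if j = 1 then (φ ⟨k, h⟩).1.2.1
    else if j = 2 then (φ ⟨k, h⟩).1.2.2 else 0 else 0
  let value : ℕ → ℕ → K := fun k j =>
    if j = 0 then if h : k < E.card then
      f (φ ⟨k, h⟩).1.1 (φ ⟨k, h⟩).1.2.1 (φ ⟨k, h⟩).1.2.2 else 0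
    else if h : k < q ∧ j - 1 < n then if ⟨j - 1, h.2⟩ ∈ S ⟨k, h.1⟩ then 1 else 0 else 0
  let g : Guess K :=
    { idx := Finsupp.onFinset (Finset.range E.card ×ˢ Finset.range 3) (fun p => entry p.1 p.2) (by
        rintro ⟨k, j⟩ hkj
        simp only [Finset.mem_product, Finset.mem_range]
        by_contra h
        refine hkj ?_
        simp only [entry]
        split_ifs <;> first | rfl | omega)
      num := Finsupp.onFinset (Finset.range (E.card + q) ×ˢ Finset.range (n + 1))
        (fun p => value p.1 p.2) (by
          rintro ⟨k, j⟩ hkj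
          simp only [Finset.mem_product, Finset.mem_range]
          by_contra h
          refine hkj ?_
          simp only [value]
          split_ifs <;> first | rfl | omega) }
  have gi : ∀ k j, g.idx (k, j) = entry k j := fun _ _ => rfl
  have gn : ∀ k j, g.num (k, j) = value k j := fun _ _ => rfl
  refine ⟨g, fun k => ?_, fun i a b => ?_, fun i => ?_⟩
  · simp only [gi, gn, entry, value]
    by_cases h : k < E.card <;> simp [h, hq, hn, h₀]
  · rw [guessFlow, ← Finset.sum_subset (Finset.range_subset_range.2 hE), Finset.sum_range]
    · let h : Fin q × Fin n × Fin n → K := fun e => if e = (i, a, b) then f e.1 e.2.1 e.2.2 else 0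
      have : ∀ k : Fin E.card, (if g.idx (k, 0) = i ∧ g.idx (k, 1) = a ∧ g.idx (k, 2) = b then
          g.num (k, 0) else 0) =
          h (φ k).1 := by
        intro k
        simp only [h, gi, gn, entry, value, k.2, dif_pos, if_true, Fin.eta]
        refine if_congr ?_ rfl rfl
        simp [Prod.ext_iff, Fin.ext_iff]
      refine (Finset.sum_congr rfl fun k _ => this k).trans ((Equiv.sum_comp φ fun e => h e.1).trans
        ((Finset.sum_coe_sort E h).trans ?_))
      rw [Finset.sum_ite_eq']
      simp only [E, Finset.mem_filter, Finset.mem_univ, true_and]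
      split_ifs with h
      · rfl
      · push Not at h; exact h.symm
    · intro k _ hk
      have : ¬ k < E.card := by simpa using hk
      simp [gn, value, this]
  · ext w
    simp only [guessCut, Finset.mem_filter, Finset.mem_univ, true_and, gn, value]
    by_cases h : w ∈ S i <;> simp [h]

/-- Completeness: maximum flows within the budget are part of some accepted guess. -/
theorem exists_accepts (x : Query K n q) {B : ℕ} {f : Fin q → Fin n → Fin n → K}
    (hf : ∀ i, IsMaxFlow x.graph (x.pair i).1 (x.pair i).2 (f i)) (hB : ∑ i, vol (f i) ≤ B) :
    ∃ g : Guess K, Accepts x B g := by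
  have hn : 0 < n := (x.pair ⟨0, x.nonempty⟩).1.pos
  -- minimum cuts that certify the given flows
  choose S hS hval using fun i => exists_cut_of_isMaxFlow (x.distinct i) (hf i)
  obtain ⟨g, hg, hgf, hgS⟩ := exists_guess x.nonempty hn f (fun i => (hf i).1.nonneg) hB S
  have hx : ∀ k < B, 0 ≤ g.num (k, 0) := fun k _ => (hg k).2.2.2
  have hnet : ∀ (i : Fin q) (w : Fin n), guessNet B g i w = ∑ b, f i w b - ∑ a, f i a w :=
    fun i w => by
      rw [guessNet_eq (n := n) (fun k _ => (hg k).2.1) fun k _ => (hg k).2.2.1]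
      simp only [hgf]
  have hout : ∀ (i : Fin q) (w : Fin n), guessOut B g i w = ∑ b, f i w b := fun i w => by
    rw [← sum_guessFlow_tail (n := n) fun k _ => (hg k).2.2.1]
    simp only [hgf]
  refine ⟨g, fun k hk => ⟨(hg k).1, (hg k).2.1, (hg k).2.2.1, hx k hk, ?_⟩,
    fun i => ⟨fun w => ?_, ?_⟩⟩
  · rw [tally_edgeCell (fun k' _ => (hg k').1) (fun k' _ => (hg k').2.1) (hg k).1 (hg k).2.1]
    have h₁ := guessFlow_mono (Nat.succ_le_of_lt hk) hx (g.idx (k, 0)) (g.idx (k, 1))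
      (g.idx (k, 2))
    have h₂ := le_guessFlow hk hx
    obtain ⟨i, hi⟩ : ∃ i : Fin q, (i : ℕ) = g.idx (k, 0) := ⟨⟨_, (hg k).1⟩, rfl⟩
    obtain ⟨a, ha⟩ : ∃ a : Fin n, (a : ℕ) = g.idx (k, 1) := ⟨⟨_, (hg k).2.1⟩, rfl⟩
    obtain ⟨b, hb⟩ : ∃ b : Fin n, (b : ℕ) = g.idx (k, 2) := ⟨⟨_, (hg k).2.2.1⟩, rfl⟩
    rw [← hi, ← ha, ← hb, hgf] at h₁ h₂
    rw [← hi, ← ha, ← hb, show table x.graph.weight a b = x.graph.weight a b by simp [table]]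
    have hr := (hf i).1.respects
    cases hG : x.graph with
    | edgeCap c hc =>
      rw [hG] at hr
      exact h₁.trans (hr a b)
    | nodeCap adj c hc =>
      rw [hG] at hr
      simp only [CapGraph.kind, CapGraph.weight, one_ne_zero, if_false]
      intro hw
      refine h₂.trans (le_of_eq ?_)
      by_contra hne
      rw [if_pos (hr.1 a b hne)] at hw
      exact absurd hw (not_le.2 one_pos)
  · have hmem : 0 < g.num (i, (w : ℕ) + 1) ↔ w ∈ S i := by rw [← hgS i]; simp [guessCut]
    obtain ⟨hu, hv, hadj⟩ := hS i
    rw [NodeTest]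
    split_ifs with h₁ h₂
    · rw [Fin.ext h₁] at hmem ⊢
      exact hmem.2 hu
    · rw [Fin.ext h₂] at hmem ⊢
      refine ⟨not_lt.1 fun h => hv (hmem.1 h), ?_⟩
      rw [cutMatrix_mul_apply, hgS]
      cases hG : x.graph with
      | edgeCap c hc => exact Or.inl rfl
      | nodeCap adj c hc =>
        rw [hG] at hadj
        right
        simp only [CapGraph.weight]
        exact (sum_adj_nonpos_iff adj (S i) _).2 hadj
    · have hwu : w ≠ (x.pair i).1 := fun h => h₁ (congrArg _ h)
      have hwv : w ≠ (x.pair i).2 := fun h => h₂ (congrArg _ h)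
      refine ⟨by rw [hnet, (hf i).1.conservation w hwu hwv, sub_self], ?_⟩
      rw [hout]
      have hr := (hf i).1.respects
      cases hG : x.graph with
      | edgeCap c hc => exact Or.inl rfl
      | nodeCap adj c hc =>
        rw [hG] at hr
        exact Or.inr (hr.2 w hwu hwv)
  · rw [guessCap_eq_cutCap, hgS, ← hval i, hnet, val]

end MaxFlow

/-! ### Nondeterministic time bounds -/

namespace MaxFlow

open NumRAM

variable {K : Type*} [Field K] [LinearOrder K] [IsStrictOrderedRing K]

theorem nondetMaxFlowTime_of_rectMatMulTime {D : Set (ℕ × ℕ)} {T : ℕ → ℕ → ℝ}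
    (h : RectMatMulTime K D T) : NondetMaxFlowTime K D T := by
  obtain ⟨P, hP⟩ := h
  refine ⟨verifier P, 100, fun n q hqn x B => ⟨fun g => ?_, fun f hf hB => ?_⟩⟩
  · obtain ⟨k, ok, s', hk, hs', hok, hval⟩ := verifier_spec (hP q n hqn) x B g
    refine ⟨k, ok, s', hk, hs', fun h i => ?_⟩
    rw [hval]
    exact (hok.1 h).isMaxFlowValue i
  · obtain ⟨g, hg⟩ := exists_accepts x hf hB
    obtain ⟨k, ok, s', -, hs', hok, -⟩ := verifier_spec (hP q n hqn) x B g
    rw [hok.2 hg] at hs'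
    exact ⟨g, k, s', hs'⟩

omit [IsStrictOrderedRing K] in
/-- A query has at least one node, so other shapes do not matter; and only the order of magnitude
of the time bound does. -/
theorem NondetMaxFlowTime.mono {D D' : Set (ℕ × ℕ)} {T T' : ℕ → ℕ → ℝ} {C' : ℝ} (hC' : 0 ≤ C')
    (h : NondetMaxFlowTime K D T) (hD : ∀ q n, 0 < n → (q, n) ∈ D' → (q, n) ∈ D)
    (hT₀ : ∀ q n, 0 < n → 0 ≤ T q n ∧ 0 ≤ T' q n) (hT : ∀ q n, 0 < n → T q n ≤ C' * T' q n) :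
    NondetMaxFlowTime K D' T' := by
  obtain ⟨M, C, hM⟩ := h
  refine ⟨M, |C| * (C' + 1), fun n q hqn x B => ?_⟩
  have hn : 0 < n := (x.pair ⟨0, x.nonempty⟩).1.pos
  refine ⟨fun g => ?_, (hM n q (hD q n hn hqn) x B).2⟩
  obtain ⟨k, ok, s', hk, hs'⟩ := (hM n q (hD q n hn hqn) x B).1 g
  refine ⟨k, ok, s', hk.trans ?_, hs'⟩
  have hB : (0 : ℝ) ≤ B := Nat.cast_nonneg B
  obtain ⟨h₁, h₂⟩ := hT₀ q n hn
  have h₃ := hT q n hn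
  calc C * (T q n + B) ≤ |C| * (T q n + B) := by
        gcongr; exact le_abs_self C
    _ ≤ |C| * ((C' + 1) * (T' q n + B)) := by
        gcongr
        nlinarith [mul_nonneg hC' hB]
    _ = |C| * (C' + 1) * (T' q n + B) := by ring

/-- Some exponent below `τ` is attained by a program, up to a constant factor. -/
theorem nondetMaxFlowTime_of_omega_lt {κ τ : ℝ} (h : omega K κ 1 1 < (τ : EReal)) :
    NondetMaxFlowTime K {p : ℕ × ℕ | (p.1 : ℝ) ≤ (p.2 : ℝ) ^ κ} (fun _ n => (n : ℝ) ^ τ) := by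
  obtain ⟨_, ⟨τ', rfl, P, C, hP⟩, hτ⟩ := sInf_lt_iff.1 h
  have hτ : τ' < τ := EReal.coe_lt_coe_iff.1 hτ
  have hmul : RectMatMulTime K {p : ℕ × ℕ | 0 < p.2 ∧ (p.1 : ℝ) ≤ (p.2 : ℝ) ^ κ}
      (fun _ n => C * (n : ℝ) ^ τ') :=
    ⟨P, fun q n hqn => hP n q n n hqn.1 hqn.2 (by simp) (by simp)⟩
  have hC : 0 ≤ C := by
    have := (hP 1 0 0 0 le_rfl (by simp) (by simp) (by simp)).1
    simpa using this
  refine (nondetMaxFlowTime_of_rectMatMulTime hmul).mono hC (fun q n hn h => ⟨hn, h⟩)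
    (fun q n _ => ⟨by positivity, by positivity⟩) fun q n hn => ?_
  have : (1 : ℝ) ≤ n := by exact_mod_cast hn
  gcongr

end MaxFlow

theorem mainTheorem9 (K : Type*) [Field K] [LinearOrder K] [IsStrictOrderedRing K] :
    (∀ (D : Set (ℕ × ℕ)) (T : ℕ → ℕ → ℝ),
      NumRAM.RectMatMulTime K D T → MaxFlow.NondetMaxFlowTime K D T) ∧
    (∀ κ τ : ℝ, NumRAM.omega K κ 1 1 < (τ : EReal) →
      MaxFlow.NondetMaxFlowTime K {p : ℕ × ℕ | (p.1 : ℝ) ≤ (p.2 : ℝ) ^ κ}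
        (fun _ n => (n : ℝ) ^ τ)) :=
  ⟨fun _ _ => MaxFlow.nondetMaxFlowTime_of_rectMatMulTime,
    fun _ _ => MaxFlow.nondetMaxFlowTime_of_omega_lt⟩
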